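/- A temporal graph $\mathcal G=(G,\lambda)$ consists of a finite static graph $G=(V,E)$ and a map $\lambda$ assigning to each edge a finite set of positive integers, the times at which it is active; a time-edge is a pair $(e,t)$ with $e\in E$, $t\in\lambda(e)$. We consider temporal graphs with at least one time-edge. The lifetime $\Lambda$ is the largest $t$ occurring in a time-edge. A (strict) temporal path is a walk in $G$ visiting each vertex at most once, whose consecutive edges $e_i$ are used at times $t_i\in\lambda(e_i)$ with $t_1<t_2<\cdots$. The problem Temporal Hamiltonian Path asks whether a given temporal graph has a temporal path containing every vertex. A TIM (tree-interval-membership) decomposition of $\mathcal G$ is a finite directed tree $T$ (a digraph whose underlying undirected graph is a tree) with a bag $B(s)\subseteq V$ and a time $\tau(s)\in\{1,\dots,\Lambda\}$ for each node $s$ of $T$, such that (1) for every vertex $v$ and every $t\in\{1,\dots,\Lambda\}$ there is a unique node $s$ with $\tau(s)=t$ and $v\in B(s)$; (2) for every time-edge $(uv,t)$ there is a unique node $s$ with $\{u,v\}\subseteq B(s)$ and $\tau(s)=t$; (3) $(i,j)$ is an arc of $T$ if and only if $B(i)\cap B(j)\neq\emptyset$ and $\tau(j)=\tau(i)+1$.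 Its width is $\max_s|B(s)|$, and the TIM width $\phi$ of $\mathcal G$ is the minimum width of a TIM decomposition of $\mathcal G$. **Theorem.** Temporal Hamiltonian Path can be solved in time $(n\Lambda)^{O(1)}\,3^{O(\phi^3)}$, where the input temporal graph has $n$ vertices, lifetime $\Lambda$ and TIM width $\phi$. That is, there are a random access machine program (unit cost, with addition and truncated subtraction but no multiplication; the input consists of $n$, $\Lambda$ and the adjacency matrices of the graphs of edges active at times $1,\dots,\Lambda$) and a constant $c$ such that on every temporal graph with at least one time-edge the program halts with the correct answer after at most $(n\Lambda)^c\,3^{c\phi^3}$ steps. In particular, the problem is fixed-parameter tractable parameterised by TIM width: it is solved in at most $f(\phi)\,|x|^{c}$ steps for some computable $f$ and constant $c$, where $|x|$ is the input length. -/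

import Mathlib

/-! ## A random access machine with a step count -/

namespace RAM

/-- The memory of the machine: registers `reg i` and arrays `arr a`, all of whose cells hold
natural numbers.  A program mentions only finitely many registers and arrays. -/
structure Store where
  reg : ℕ → ℕ
  arr : ℕ → ℕ → ℕ

/-- The elementary instructions.  Registers and arrays are named by numerals that are fixed in the
program; the cells of an array are addressed through the content of a register.  There are no
multiplications, so that unit cost is polynomially related to the cost on Turing machines. -/
inductive Instr where
  | nop
  | const (r k : ℕ)
  | copy (r x : ℕ)
  | add (r x y : ℕ)
  | sub (r x y : ℕ)
  | load (r a x : ℕ)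
  | store (a x r : ℕ)

/-- The effect of an elementary instruction (`sub` is truncated subtraction). -/
def Instr.run : Instr → Store → Store
  | .nop, s => s
  | .const r k, s => { s with reg := Function.update s.reg r k }
  | .copy r x, s => { s with reg := Function.update s.reg r (s.reg x) }
  | .add r x y, s => { s with reg := Function.update s.reg r (s.reg x + s.reg y) }
  | .sub r x y, s => { s with reg := Function.update s.reg r (s.reg x - s.reg y) }
  | .load r a x, s => { s with reg := Function.update s.reg r (s.arr a (s.reg x)) }
  | .store a x r, s =>
      { s with arr := Function.update s.arr a (Function.update (s.arr a) (s.reg x) (s.reg r)) }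

/-- The tests: equality and strict comparison of two registers. -/
inductive Test where
  | eq (x y : ℕ)
  | lt (x y : ℕ)

/-- The truth of a test in a store. -/
def Test.Holds : Test → Store → Prop
  | .eq x y, s => s.reg x = s.reg y
  | .lt x y, s => s.reg x < s.reg y

/-- Programs: instructions, sequential composition, branching and while loops. -/
inductive Prog where
  | instr (i : Instr)
  | seq (p q : Prog)
  | branch (b : Test) (p q : Prog)
  | loop (b : Test) (p : Prog)

/-- `Exec p s t s'`: started in `s`, the program `p` halts in `s'` after exactly `t` steps.  Every
elementary instruction and every evaluation of a test is one step. -/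
inductive Exec : Prog → Store → ℕ → Store → Prop where
  | instr (i : Instr) (s : Store) : Exec (.instr i) s 1 (i.run s)
  | seq {p q : Prog} {s s₁ s₂ : Store} {t₁ t₂ : ℕ} :
      Exec p s t₁ s₁ → Exec q s₁ t₂ s₂ → Exec (.seq p q) s (t₁ + t₂) s₂
  | branch_true {b : Test} {p q : Prog} {s s' : Store} {t : ℕ} :
      b.Holds s → Exec p s t s' → Exec (.branch b p q) s (t + 1) s'
  | branch_false {b : Test} {p q : Prog} {s s' : Store} {t : ℕ} :
      ¬ b.Holds s → Exec q s t s' → Exec (.branch b p q) s (t + 1) s'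
  | loop_done {b : Test} {p : Prog} {s : Store} :
      ¬ b.Holds s → Exec (.loop b p) s 1 s
  | loop_step {b : Test} {p : Prog} {s s₁ s₂ : Store} {t₁ t₂ : ℕ} :
      b.Holds s → Exec p s t₁ s₁ → Exec (.loop b p) s₁ t₂ s₂ →
      Exec (.loop b p) s (t₁ + t₂ + 1) s₂

/-- The machine is deterministic: the final store and the number of steps are unique. -/
theorem Exec.unique {p : Prog} {s s₁ : Store} {t₁ : ℕ} (h₁ : Exec p s t₁ s₁) :
    ∀ {s₂ : Store} {t₂ : ℕ}, Exec p s t₂ s₂ → t₁ = t₂ ∧ s₁ = s₂ := by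
  induction h₁ with
  | instr i s => intro s₂ t₂ h; cases h; exact ⟨rfl, rfl⟩
  | seq _ _ ih₁ ih₂ =>
    intro s₂ t₂ h
    cases h with
    | seq h₁ h₂ =>
      obtain ⟨rfl, rfl⟩ := ih₁ h₁
      obtain ⟨rfl, rfl⟩ := ih₂ h₂
      exact ⟨rfl, rfl⟩
  | branch_true hb _ ih =>
    intro s₂ t₂ h
    cases h with
    | branch_true _ h => obtain ⟨rfl, rfl⟩ := ih h; exact ⟨rfl, rfl⟩
    | branch_false hb' _ => exact absurd hb hb'
  | branch_false hb _ ih =>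
    intro s₂ t₂ h
    cases h with
    | branch_true hb' _ => exact absurd hb' hb
    | branch_false _ h => obtain ⟨rfl, rfl⟩ := ih h; exact ⟨rfl, rfl⟩
  | loop_done hb =>
    intro s₂ t₂ h
    cases h with
    | loop_done _ => exact ⟨rfl, rfl⟩
    | loop_step hb' _ _ => exact absurd hb' hb
  | loop_step hb _ _ ih₁ ih₂ =>
    intro s₂ t₂ h
    cases h with
    | loop_done hb' => exact absurd hb hb'
    | loop_step _ h₁ h₂ =>
      obtain ⟨rfl, rfl⟩ := ih₁ h₁
      obtain ⟨rfl, rfl⟩ := ih₂ h₂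
      exact ⟨rfl, rfl⟩

/-- The initial store: the input word stands in array `0`, everything else is zero. -/
def init (input : List ℕ) : Store where
  reg := fun _ => 0
  arr := fun a k => if a = 0 then input.getD k 0 else 0

/-- On the given input `p` halts within `T` steps, and register `0` finally contains the answer to
the question `yes` (`1` for true, `0` for false). -/
def DecidesWithin (p : Prog) (input : List ℕ) (yes : Prop) (T : ℕ) : Prop :=
  ∃ (t : ℕ) (s : Store), Exec p (init input) t s ∧ t ≤ T ∧
    (yes → s.reg 0 = 1) ∧ (¬ yes → s.reg 0 = 0)

/-- Fixed-parameter tractability of the decision problem `yes` on the instances `I`, given to the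
machine through `enc`, with respect to the parameter `κ`. -/
def FixedParameterTractable {I : Type*} (enc : I → List ℕ) (yes : I → Prop) (κ : I → ℕ) : Prop :=
  ∃ (p : Prog) (f : ℕ → ℕ) (c : ℕ), Computable f ∧
    ∀ x : I, DecidesWithin p (enc x) (yes x) (f (κ x) * (enc x).length ^ c)

end RAM

/-! ## Temporal graphs -/

/-- A temporal graph on the vertex set `V`: a static graph together with a map that assigns to each
of its edges the finite set of the (positive) times at which it is active. -/
structure TemporalGraph (V : Type*) where
  underlying : SimpleGraph V
  label : underlying.edgeSet → Finset ℕ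
  label_pos : ∀ e, ∀ t ∈ label e, 1 ≤ t

namespace TemporalGraph

variable {V : Type*}

/-- `(e, t)` is a time-edge. -/
def TimeEdge (G : TemporalGraph V) (e : Sym2 V) (t : ℕ) : Prop :=
  ∃ h : e ∈ G.underlying.edgeSet, t ∈ G.label ⟨e, h⟩

/-- The snapshot at time `t`. -/
def snapshot (G : TemporalGraph V) (t : ℕ) : SimpleGraph V where
  Adj u v := G.TimeEdge s(u, v) t
  symm := ⟨fun u v h => by rw [Sym2.eq_swap]; exact h⟩
  loopless := ⟨fun u h => G.underlying.loopless.irrefl u h.1⟩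

/-- There is at least one time-edge (otherwise there is no latest time of activity). -/
def HasTimeEdge (G : TemporalGraph V) : Prop :=
  ∃ e t, G.TimeEdge e t

/-- The lifetime: the latest time at which an edge is active. -/
noncomputable def lifetime (G : TemporalGraph V) : ℕ :=
  sSup {t | ∃ e, G.TimeEdge e t}

/-- The lifetime is attained and is the latest time of activity. -/
theorem isGreatest_lifetime [Finite V] (G : TemporalGraph V) (hG : G.HasTimeEdge) :
    IsGreatest {t | ∃ e, G.TimeEdge e t} G.lifetime := by
  have hfin : {t | ∃ e, G.TimeEdge e t}.Finite := by
    refine (Set.finite_iUnion (fun e : G.underlying.edgeSet =>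
      (G.label e).finite_toSet)).subset ?_
    rintro t ⟨e, h, ht⟩
    exact Set.mem_iUnion.2 ⟨⟨e, h⟩, ht⟩
  obtain ⟨e, t, h⟩ := hG
  exact ⟨Nat.sSup_mem ⟨t, e, h⟩ hfin.bddAbove, fun s hs => le_csSup hfin.bddAbove hs⟩

/-- A (strict) temporal walk: a walk whose successive edges are used at strictly increasing times
at which they are active. -/
structure Walk (G : TemporalGraph V) where
  length : ℕ
  vert : Fin (length + 1) → V
  time : Fin length → ℕ
  active : ∀ i : Fin length, G.TimeEdge s(vert i.castSucc, vert i.succ) (time i)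
  increasing : StrictMono time

/-- A temporal path traverses each vertex at most once. -/
def Walk.IsPath {G : TemporalGraph V} (w : G.Walk) : Prop :=
  Function.Injective w.vert

/-- The question of Temporal Hamiltonian Path: is there a temporal path that contains every
vertex? -/
def HasHamiltonianPath (G : TemporalGraph V) : Prop :=
  ∃ w : G.Walk, w.IsPath ∧ ∀ v : V, ∃ i, w.vert i = v

/-! ## Tree-interval-membership width -/

/-- A tree-interval-membership decomposition: a finite directed tree (a digraph whose underlying
undirected graph is a tree), with a bag of vertices and a time in `{1, …, Λ}` at each node. -/
structure TIMDecomposition (G : TemporalGraph V) where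
  Node : Type
  [fintypeNode : Fintype Node]
  tree : Digraph Node
  isTree : tree.toSimpleGraphInclusive.IsTree
  bag : Node → Finset V
  time : Node → ℕ
  time_mem : ∀ i, 1 ≤ time i ∧ time i ≤ G.lifetime
  vertex_unique : ∀ (v : V) (t : ℕ), 1 ≤ t → t ≤ G.lifetime → ∃! i, time i = t ∧ v ∈ bag i
  edge_unique : ∀ (u v : V) (t : ℕ), G.TimeEdge s(u, v) t →
    ∃! i, (u ∈ bag i ∧ v ∈ bag i) ∧ time i = t
  arc_iff : ∀ i j, tree.Adj i j ↔ (∃ v, v ∈ bag i ∧ v ∈ bag j) ∧ time j = time i + 1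

/-- The width of a decomposition: the largest cardinality of a bag. -/
def TIMDecomposition.width {G : TemporalGraph V} (D : G.TIMDecomposition) : ℕ :=
  letI := D.fintypeNode
  Finset.univ.sup fun i => (D.bag i).card

/-- The TIM width: the least width of a TIM decomposition. -/
noncomputable def timWidth (G : TemporalGraph V) : ℕ :=
  sInf {φ | ∃ D : G.TIMDecomposition, D.width = φ}

/-- The TIM width is attained by a decomposition. -/
theorem exists_timDecomposition [Finite V] (G : TemporalGraph V) (hG : G.HasTimeEdge) :
    ∃ D : G.TIMDecomposition, D.width = G.timWidth := by
  suffices h : {φ | ∃ D : G.TIMDecomposition, D.width = φ}.Nonempty from Nat.sInf_mem h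
  have := Fintype.ofFinite V
  have hL := G.isGreatest_lifetime hG
  obtain ⟨⟨e₀, he₀, ht₀⟩, hub⟩ := hL
  have hpos := G.label_pos _ _ ht₀
  obtain ⟨m, hm⟩ : ∃ m, G.lifetime = m + 1 := ⟨G.lifetime - 1, by omega⟩
  have hV : Nonempty V := e₀.ind fun u _ => ⟨u⟩
  let T : Digraph (Fin (m + 1)) := ⟨fun i j => (j : ℕ) = i + 1⟩
  have hT : T.toSimpleGraphInclusive = SimpleGraph.pathGraph (m + 1) := by
    ext i j
    simp only [Digraph.toSimpleGraphInclusive, SimpleGraph.fromRel_adj,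
      SimpleGraph.pathGraph_adj, T, ne_eq, Fin.ext_iff]
    omega
  have hconn := SimpleGraph.pathGraph_connected m
  have htree : T.toSimpleGraphInclusive.IsTree := by
    rw [hT, SimpleGraph.isTree_iff_connected_and_card]
    refine ⟨hconn, le_antisymm ?_ hconn.card_vert_le_card_edgeSet_add_one⟩
    have hs : Function.Surjective (fun i : Fin m =>
        (⟨s(i.castSucc, i.succ), by simp [SimpleGraph.pathGraph_adj]⟩ :
          (SimpleGraph.pathGraph (m + 1)).edgeSet)) := by
      rintro ⟨e, he⟩
      induction e with
      | _ u v =>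
        rw [SimpleGraph.mem_edgeSet, SimpleGraph.pathGraph_adj] at he
        rcases he with h | h
        · refine ⟨⟨u, by omega⟩, Subtype.ext (Sym2.eq_iff.2 (Or.inl ⟨?_, ?_⟩))⟩ <;>
            simp [h]
        · refine ⟨⟨v, by omega⟩, Subtype.ext (Sym2.eq_iff.2 (Or.inr ⟨?_, ?_⟩))⟩ <;>
            simp [h]
    have := Nat.card_le_card_of_surjective _ hs
    simpa using this
  have huniq : ∀ t, 1 ≤ t → t ≤ G.lifetime → ∃! i : Fin (m + 1), (i : ℕ) + 1 = t := by
    intro t h1 h2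
    refine ⟨⟨t - 1, by omega⟩, by simp; omega, fun j hj => Fin.ext ?_⟩
    simp only at hj ⊢
    omega
  exact ⟨_, {
    Node := Fin (m + 1)
    tree := T
    isTree := htree
    bag := fun _ => Finset.univ
    time := fun i => (i : ℕ) + 1
    time_mem := fun i => by omega
    vertex_unique := fun v t h1 h2 => by simpa using huniq t h1 h2
    edge_unique := fun u v t h => by
      simpa using huniq t (G.label_pos _ _ h.2) (hub ⟨_, h⟩)
    arc_iff := fun i j => by simp [T] }, rfl⟩

/-! ## The input of the machine -/

open Classical in
/-- The input word of a temporal graph on the vertices `0, …, n - 1`: the number `n`, the lifetime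
`Λ`, and then the adjacency matrices of the snapshots at the times `1, …, Λ`, row by row. -/
noncomputable def encode {n : ℕ} (G : TemporalGraph (Fin n)) : List ℕ :=
  n :: G.lifetime :: (List.range G.lifetime).flatMap fun t =>
    (List.finRange n).flatMap fun u => (List.finRange n).map fun v =>
      if G.TimeEdge s(u, v) (t + 1) then 1 else 0

/-- The instances: temporal graphs on `n` vertices, for any `n`, with at least one time-edge. -/
structure Instance where
  n : ℕ
  graph : TemporalGraph (Fin n)
  hasTimeEdge : graph.HasTimeEdge

end TemporalGraph

/-!
A Hamiltonian temporal path is searched from its end, backwards in time.  The state `(t, v, S)` of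
the search says that `S` is the vertex set of a temporal path that starts in `v` and uses only times
later than `t`; the next state `(t - 1, w, S ∪ {w})` has `w = v`, or an edge `vw` that is active at
time `t` with `w ∉ S`.  A state is kept only if every vertex outside `S` can reach its current
vertex at times up to its own time, which holds at each state on a Hamiltonian path.  At time `0`
this condition forces `S` to be the set of all vertices, so a Hamiltonian path exists if and only if
some state at time `0` is found (`hasHamiltonianPath_iff`).

The search never looks at a TIM decomposition; that is needed only to count the states
(`SuffixState.card_le`).  At each moment the traveller is in one bag, and as time passes these bags
form a directed walk in the tree.  Two directed walks with the same ends are equal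
(`TIMDecomposition.walk_unique`).  So if a vertex `u` lies in a bag of the walk at a time later than
`t` and can also reach `v` at times up to `t`, the walk of bags around `u` has to pass through the
bag at time `t + 1` around `v`.  Hence all vertices in the bags of the walk that are not in this one
bag have been visited, and `S` is determined by `t`, `v`, the last vertex of the path and the
intersection of `S` with a bag of at most `φ` vertices (`SuffixState.exists_bag`).  This leaves at
most `(Λ + 1) n² 2 ^ φ` states.

On the random access machine, the relation "`u` reaches `v` at times up to `t`" is tabulated time by
time (`reachProg_runs`), and the states are collected in a list that is scanned while it grows
(`searchProg_runs`).  A set of vertices is coded by a multiple of `∑ 2 ^ u`, a single number which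
serves as an address, so that membership in a set and presence of a state in the list are looked up
in one step.  The number of steps is polynomial in `n` and `Λ` for each state.
-/

open RAM

namespace TemporalGraph

/-! ### Suffix states of temporal paths -/

variable {V : Type*}

/-- `G.ReachBy t v u`: a strict temporal walk leads from `u` to `v` at times in `{1, …, t}`. -/
def ReachBy (G : TemporalGraph V) : ℕ → V → V → Prop
  | 0, v, u => v = u
  | t + 1, v, u => G.ReachBy t v u ∨ ∃ w, G.TimeEdge s(v, w) (t + 1) ∧ G.ReachBy t w u

/-- The states of the search, which builds Hamiltonian paths from their end backwards in time.
In the state `(t, v, S)` the set `S` is the vertex set of a temporal path that starts in `v` and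
uses only times later than `t`.  Apart from the initial states `(Λ, v, {v})`, a state is dropped
unless all vertices outside `S` can still reach `v` at times up to `t`. -/
inductive SuffixState [DecidableEq V] (G : TemporalGraph V) : ℕ → V → Finset V → Prop
  | last (v : V) : SuffixState G G.lifetime v {v}
  | prev {t : ℕ} {v w : V} {S : Finset V} : SuffixState G (t + 1) v S →
      (w = v ∨ G.TimeEdge s(v, w) (t + 1) ∧ w ∉ S) → (∀ u ∉ insert w S, G.ReachBy t w u) →
      SuffixState G t w (insert w S)

theorem ReachBy.mono {G : TemporalGraph V} {t : ℕ} {v u : V} (h : G.ReachBy t v u) :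
    G.ReachBy (t + 1) v u := Or.inl h

theorem ReachBy.refl (G : TemporalGraph V) (t : ℕ) (v : V) : G.ReachBy t v v := by
  induction t with
  | zero => rfl
  | succ t ih => exact ih.mono

theorem timeEdge_comm (G : TemporalGraph V) (u v : V) (t : ℕ) :
    G.TimeEdge s(u, v) t ↔ G.TimeEdge s(v, u) t := by
  rw [Sym2.eq_swap]

theorem TimeEdge.ne {G : TemporalGraph V} {u v : V} {t : ℕ} (h : G.TimeEdge s(u, v) t) : u ≠ v := by
  obtain ⟨h, -⟩ := h
  exact SimpleGraph.Adj.ne h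

theorem TimeEdge.pos {G : TemporalGraph V} {e : Sym2 V} {t : ℕ} (h : G.TimeEdge e t) : 1 ≤ t := by
  obtain ⟨_, h⟩ := h
  exact G.label_pos _ _ h

/-- Along a temporal walk, earlier vertices reach later ones: no state on a Hamiltonian path is
dropped by the search. -/
theorem Walk.reachBy {G : TemporalGraph V} (w : G.Walk) (t : ℕ) : ∀ j : Fin (w.length + 1),
    (∀ i : Fin w.length, i.castSucc < j → w.time i ≤ t) →
    ∀ i ≤ j, G.ReachBy t (w.vert j) (w.vert i) := by
  induction t with
  | zero =>
    intro j hj i hij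
    rcases hij.eq_or_lt with rfl | hij
    · rfl
    · have hi : (i : ℕ) < w.length := by
        have := j.2
        have : (i : ℕ) < j := hij
        omega
      have h1 := hj ⟨i, hi⟩ hij
      have h2 := (w.active ⟨i, hi⟩).pos
      omega
  | succ t ih =>
    intro j hj i hij
    by_cases hlast : ∀ i : Fin w.length, i.castSucc < j → w.time i ≤ t
    · exact (ih j hlast i hij).mono
    · push Not at hlast
      obtain ⟨k, hkj, hk⟩ := hlast
      have hkt : w.time k = t + 1 := le_antisymm (hj k hkj) hk
      have hkj' : j = k.succ := by
        by_contra hne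
        have h1 : (k : ℕ) + 1 < j := by
          have h2 : (k : ℕ) < j := hkj
          have h3 : (j : ℕ) ≠ k + 1 := fun h => hne (Fin.ext h)
          omega
        have h2 : (k : ℕ) + 1 < w.length := by omega
        have h3 := hj ⟨k + 1, h2⟩ h1
        have h4 : w.time k < w.time ⟨k + 1, h2⟩ := w.increasing (Fin.lt_def.2 (by simp))
        omega
      subst hkj'
      rcases hij.eq_or_lt with rfl | hij
      · exact ReachBy.refl _ _ _
      · refine Or.inr ⟨w.vert k.castSucc, ?_, ih k.castSucc ?_ i ?_⟩
        · rw [← hkt, timeEdge_comm]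
          exact w.active k
        · intro i hi
          have : w.time i < w.time k := w.increasing hi
          omega
        · exact Fin.le_castSucc_iff.2 hij

section
variable [DecidableEq V] {G : TemporalGraph V}

theorem SuffixState.mem {t : ℕ} {v : V} {S : Finset V} (h : G.SuffixState t v S) : v ∈ S := by
  cases h <;> simp

theorem SuffixState.le_lifetime {t : ℕ} {v : V} {S : Finset V} (h : G.SuffixState t v S) :
    t ≤ G.lifetime := by
  induction h with
  | last v => exact le_rfl
  | prev _ _ _ ih => omega

theorem SuffixState.reachBy {t : ℕ} {v : V} {S : Finset V} (h : G.SuffixState t v S)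
    (ht : t < G.lifetime) : ∀ u ∉ S, G.ReachBy t v u := by
  cases h with
  | last v => exact absurd ht (lt_irrefl _)
  | prev _ _ h => exact h

/-- A state is the trace of a temporal path on the later times. -/
theorem SuffixState.exists_walk {t : ℕ} {v : V} {S : Finset V} (h : G.SuffixState t v S) :
    ∃ w : G.Walk, w.IsPath ∧ w.vert 0 = v ∧ (∀ i, t < w.time i) ∧
      ∀ u, u ∈ S ↔ ∃ i, w.vert i = u := by
  induction h with
  | last v =>
    refine ⟨⟨0, fun _ => v, Fin.elim0, fun i => i.elim0, fun i => i.elim0⟩, ?_, rfl,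
      fun i => i.elim0, fun u => ?_⟩
    · intro i j _
      exact Subsingleton.elim (α := Fin 1) i j
    · simp [eq_comm]
  | @prev t v x S h hx _ ih =>
    obtain ⟨w, hw, h0, ht, hS⟩ := ih
    rcases hx with rfl | ⟨hx, hxS⟩
    · refine ⟨w, hw, h0, fun i => by have := ht i; omega, fun u => ?_⟩
      rw [Finset.insert_eq_of_mem h.mem]
      exact hS u
    · refine ⟨⟨w.length + 1, Fin.cons x w.vert, Fin.cons (t + 1) w.time, fun i => ?_, ?_⟩,
        ?_, ?_, fun i => ?_, fun u => ?_⟩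
      · refine Fin.cases ?_ (fun i => ?_) i
        · simpa [h0] using (G.timeEdge_comm _ _ _).1 hx
        · have := w.active i
          simpa [← Fin.succ_castSucc] using this
      · intro i j hij
        revert hij
        refine Fin.cases ?_ (fun i => ?_) i <;> refine Fin.cases ?_ (fun j => ?_) j <;> intro hij
        · exact absurd hij (lt_irrefl _)
        · simpa using ht j
        · exact absurd hij (Nat.not_lt_zero _)
        · simpa using w.increasing (Fin.succ_lt_succ_iff.1 hij)
      · change Function.Injective (Fin.cons x w.vert : Fin (w.length + 2) → V)
        rw [Fin.cons_injective_iff]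
        refine ⟨?_, hw⟩
        rintro ⟨i, hi⟩
        exact hxS ((hS x).2 ⟨i, hi⟩)
      · rfl
      · refine Fin.cases ?_ (fun i => ?_) i
        · simp
        · have := ht i
          simp
          omega
      · rw [Finset.mem_insert, hS]
        constructor
        · rintro (rfl | ⟨i, rfl⟩)
          · exact ⟨0, rfl⟩
          · exact ⟨i.succ, by simp⟩
        · rintro ⟨i, rfl⟩
          refine Fin.cases ?_ (fun i => ?_) i
          · simp
          · right
            exact ⟨i, by simp⟩

/-- The search is complete: a Hamiltonian path passes through states only. -/
theorem HasHamiltonianPath.exists_suffixState [Fintype V] (hG : G.HasTimeEdge)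
    (h : G.HasHamiltonianPath) : ∃ v S, G.SuffixState 0 v S := by
  obtain ⟨w, hw, hall⟩ := h
  have hub : ∀ i, w.time i ≤ G.lifetime := fun i =>
    (G.isGreatest_lifetime hG).2 ⟨_, w.active i⟩
  suffices H : ∀ d ≤ G.lifetime, ∃ j : Fin (w.length + 1),
      (∀ i : Fin w.length, i.castSucc < j → w.time i ≤ G.lifetime - d) ∧
      (∀ i : Fin w.length, j ≤ i.castSucc → G.lifetime - d < w.time i) ∧
      G.SuffixState (G.lifetime - d) (w.vert j)
        (Finset.univ.filter fun u => ∃ i ≥ j, w.vert i = u) by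
    obtain ⟨j, -, -, h⟩ := H G.lifetime le_rfl
    rw [Nat.sub_self] at h
    exact ⟨_, _, h⟩
  intro d
  induction d with
  | zero =>
    refine fun _ => ⟨Fin.last _, fun i _ => hub i, fun i hi => ?_, ?_⟩
    · exact absurd hi (not_le.2 i.castSucc_lt_last)
    · have : (Finset.univ.filter fun u => ∃ i ≥ Fin.last w.length, w.vert i = u) =
          {w.vert (Fin.last _)} := by
        ext u
        simp [Fin.last_le_iff, eq_comm]
      rw [this]
      exact SuffixState.last _
  | succ d ih =>
    intro hd
    obtain ⟨j, h1, h2, h3⟩ := ih (by omega)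
    obtain ⟨t, ht⟩ : ∃ t, G.lifetime - d = t + 1 := ⟨G.lifetime - (d + 1), by omega⟩
    rw [show G.lifetime - (d + 1) = t by omega]
    rw [ht] at h1 h2 h3
    have key : ∀ j : Fin (w.length + 1), (∀ i : Fin w.length, i.castSucc < j → w.time i ≤ t) →
        ∀ u ∉ (Finset.univ.filter fun u => ∃ i ≥ j, w.vert i = u),
          G.ReachBy t (w.vert j) u := by
      intro j hj u hu
      obtain ⟨i, rfl⟩ := hall u
      refine w.reachBy t j hj i (le_of_not_ge fun hij => hu ?_)
      simp only [Finset.mem_filter, Finset.mem_univ, true_and]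
      exact ⟨i, hij, rfl⟩
    -- either no edge of the path is used at time `t + 1`, or it is the one that leads to `w.vert j`
    by_cases hlast : ∀ i : Fin w.length, i.castSucc < j → w.time i ≤ t
    · refine ⟨j, hlast, fun i hi => by have := h2 i hi; omega, ?_⟩
      have := SuffixState.prev h3 (w := w.vert j) (Or.inl rfl)
      rw [Finset.insert_eq_of_mem h3.mem] at this
      exact this (key j hlast)
    · push Not at hlast
      obtain ⟨k, hkj, hk⟩ := hlast
      have hkt : w.time k = t + 1 := le_antisymm (h1 k hkj) hk
      have hkj' : j = k.succ := by
        by_contra hne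
        have h4 : (k : ℕ) + 1 < j := by
          have h2 : (k : ℕ) < j := hkj
          have h3 : (j : ℕ) ≠ k + 1 := fun h => hne (Fin.ext h)
          omega
        have h5 : (k : ℕ) + 1 < w.length := by omega
        have h6 := h1 ⟨k + 1, h5⟩ h4
        have h7 : w.time k < w.time ⟨k + 1, h5⟩ := w.increasing (Fin.lt_def.2 (by simp))
        omega
      subst hkj'
      have hS : (Finset.univ.filter fun u => ∃ i ≥ k.castSucc, w.vert i = u) =
          insert (w.vert k.castSucc)
            (Finset.univ.filter fun u => ∃ i ≥ k.succ, w.vert i = u) := by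
        ext u
        simp only [Finset.mem_filter, Finset.mem_univ, true_and, Finset.mem_insert]
        constructor
        · rintro ⟨i, hi, rfl⟩
          rcases hi.eq_or_lt with rfl | hi
          · exact Or.inl rfl
          · exact Or.inr ⟨i, Fin.castSucc_lt_iff_succ_le.1 hi, rfl⟩
        · rintro (rfl | ⟨i, hi, rfl⟩)
          · exact ⟨_, le_rfl, rfl⟩
          · exact ⟨i, (Fin.castSucc_lt_succ.le).trans hi, rfl⟩
      have hlow : ∀ i : Fin w.length, i.castSucc < k.castSucc → w.time i ≤ t := by
        intro i hi
        have : w.time i < w.time k := w.increasing hi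
        omega
      refine ⟨k.castSucc, hlow, ?_, ?_⟩
      · intro i hi
        have : w.time k ≤ w.time i := w.increasing.monotone hi
        omega
      · have hkey := key _ hlow
        rw [hS] at hkey ⊢
        refine SuffixState.prev h3 (Or.inr ⟨?_, ?_⟩) hkey
        · rw [← hkt, timeEdge_comm]
          exact w.active k
        · simp only [Finset.mem_filter, Finset.mem_univ, true_and, not_exists, not_and]
          intro i hi he
          rw [hw he] at hi
          exact absurd hi (not_le.2 Fin.castSucc_lt_succ)

/-- The search is sound and complete: at time `0` only the vertices of `S` itself can reach `v`, so
no vertex is missing from `S`. -/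
theorem hasHamiltonianPath_iff [Fintype V] (hG : G.HasTimeEdge) :
    G.HasHamiltonianPath ↔ ∃ v S, G.SuffixState 0 v S := by
  refine ⟨fun h => h.exists_suffixState hG, ?_⟩
  rintro ⟨v, S, h⟩
  obtain ⟨w, hw, -, -, hS⟩ := h.exists_walk
  refine ⟨w, hw, fun u => (hS u).1 ?_⟩
  have hpos : 0 < G.lifetime := by
    obtain ⟨e, he⟩ := (G.isGreatest_lifetime hG).1
    exact he.pos
  by_contra hu
  have : v = u := h.reachBy hpos u hu
  exact hu (this ▸ h.mem)

end

/-! ### Few states in a temporal graph of small TIM width -/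

/-- `G.Trajectory a b x`: the sequence of positions of a traveller who sits in `x a` after time `a`
and in `x b` after time `b`. -/
def Trajectory (G : TemporalGraph V) (a b : ℕ) (x : ℕ → V) : Prop :=
  ∀ i, a ≤ i → i < b → x i = x (i + 1) ∨ G.TimeEdge s(x i, x (i + 1)) (i + 1)

theorem ReachBy.exists_trajectory {G : TemporalGraph V} {t : ℕ} {v u : V}
    (h : G.ReachBy t v u) : ∃ x, G.Trajectory 0 t x ∧ x 0 = u ∧ x t = v := by
  induction t generalizing v with
  | zero => exact ⟨fun _ => u, fun i _ h => absurd h (Nat.not_lt_zero i), rfl, h.symm⟩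
  | succ t ih =>
    obtain ⟨w, hw, h⟩ : ∃ w, (w = v ∨ G.TimeEdge s(w, v) (t + 1)) ∧ G.ReachBy t w u := by
      rcases h with h | ⟨w, hw, h⟩
      · exact ⟨v, Or.inl rfl, h⟩
      · exact ⟨w, Or.inr ((G.timeEdge_comm _ _ _).1 hw), h⟩
    obtain ⟨x, hx, h0, ht⟩ := ih h
    refine ⟨Function.update x (t + 1) v, fun i _ hi => ?_, ?_, by simp⟩
    · rcases Nat.lt_succ_iff_lt_or_eq.1 hi with hi | rfl
      · rw [Function.update_of_ne (by omega), Function.update_of_ne (by omega)]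
        exact hx i (by omega) hi
      · simpa [ht] using hw
    · rw [Function.update_of_ne (by omega), h0]

theorem SuffixState.exists_trajectory [DecidableEq V] {G : TemporalGraph V} {t : ℕ} {v : V}
    {S : Finset V} (h : G.SuffixState t v S) : ∃ x, G.Trajectory t G.lifetime x ∧ x t = v ∧
      ∀ u ∈ S, ∃ j, t ≤ j ∧ j ≤ G.lifetime ∧ x j = u := by
  induction h with
  | last v =>
    refine ⟨fun _ => v, fun i h h' => by omega, rfl, fun u hu => ⟨_, le_rfl, le_rfl, ?_⟩⟩
    exact (Finset.mem_singleton.1 hu).symm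
  | @prev t v w S h hw _ ih =>
    obtain ⟨x, hx, ht, hS⟩ := ih
    have hle := h.le_lifetime
    refine ⟨Function.update x t w, fun i hi hi' => ?_, by simp, fun u hu => ?_⟩
    · rcases hi.eq_or_lt with rfl | hi
      · rw [Function.update_self, Function.update_of_ne (by omega), ht]
        rcases hw with hw | hw
        · exact Or.inl hw
        · exact Or.inr ((G.timeEdge_comm _ _ _).1 hw.1)
      · rw [Function.update_of_ne (by omega), Function.update_of_ne (by omega)]
        exact hx i hi hi'
    · rcases Finset.mem_insert.1 hu with rfl | hu
      · exact ⟨t, le_rfl, by omega, by simp⟩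
      · obtain ⟨j, h1, h2, h3⟩ := hS u hu
        exact ⟨j, by omega, h2, by rw [Function.update_of_ne (by omega), h3]⟩

namespace TIMDecomposition

variable {G : TemporalGraph V} (D : G.TIMDecomposition)

theorem exists_walk (f : ℕ → D.Node) (a k : ℕ)
    (hf : ∀ j, a ≤ j → j < a + k → D.tree.Adj (f j) (f (j + 1))) :
    ∃ p : D.tree.toSimpleGraphInclusive.Walk (f a) (f (a + k)),
      p.support = (List.range' a (k + 1)).map f := by
  induction k generalizing a with
  | zero => exact ⟨.nil, by simp⟩
  | succ k ih =>
    obtain ⟨p, hp⟩ := ih (a + 1) fun j h h' => hf j (by omega) (by omega)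
    have harc := hf a le_rfl (by omega)
    have hadj : D.tree.toSimpleGraphInclusive.Adj (f a) (f (a + 1)) := by
      simp only [Digraph.toSimpleGraphInclusive, SimpleGraph.fromRel_adj]
      refine ⟨fun h => ?_, Or.inl harc⟩
      have := ((D.arc_iff _ _).1 harc).2
      rw [← h] at this
      omega
    refine ⟨(SimpleGraph.Walk.cons hadj p).copy rfl (by congr 1; omega), ?_⟩
    rw [SimpleGraph.Walk.support_copy, SimpleGraph.Walk.support_cons, hp, ← List.map_cons,
      ← List.range'_succ]

/-- Two directed walks with the same ends coincide: times increase along them, so they are paths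
of the underlying tree. -/
theorem walk_unique (f g : ℕ → D.Node) (a b : ℕ)
    (hf : ∀ j, a ≤ j → j < b → D.tree.Adj (f j) (f (j + 1)))
    (hg : ∀ j, a ≤ j → j < b → D.tree.Adj (g j) (g (j + 1)))
    (ha : f a = g a) (hb : f b = g b) (j : ℕ) (haj : a ≤ j) (hjb : j ≤ b) : f j = g j := by
  obtain ⟨k, rfl⟩ := Nat.exists_eq_add_of_le (haj.trans hjb)
  have hpath : ∀ f : ℕ → D.Node, (∀ j, a ≤ j → j < a + k → D.tree.Adj (f j) (f (j + 1))) →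
      ((List.range' a (k + 1)).map f).Nodup := by
    intro f hf
    have htime : ∀ i ≤ k, D.time (f (a + i)) = D.time (f a) + i := by
      intro i
      induction i with
      | zero => simp
      | succ i ih =>
        intro hi
        have h1 := ih (by omega)
        have h2 := ((D.arc_iff _ _).1 (hf (a + i) (by omega) (by omega))).2
        rw [← Nat.add_assoc, h2, h1, Nat.add_assoc]
    refine List.Nodup.map_on (fun i hi j hj hij => ?_) List.nodup_range'
    simp only [List.mem_range'_1] at hi hj
    have h1 := htime (i - a) (by omega)
    have h2 := htime (j - a) (by omega)
    rw [show a + (i - a) = i by omega] at h1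
    rw [show a + (j - a) = j by omega] at h2
    rw [hij] at h1
    omega
  obtain ⟨p, hp⟩ := D.exists_walk f a k hf
  obtain ⟨q, hq⟩ := D.exists_walk g a k hg
  have hpp : p.IsPath := by
    rw [SimpleGraph.Walk.isPath_def, hp]
    exact hpath f hf
  have hqp : (q.copy ha.symm hb.symm).IsPath := by
    rw [SimpleGraph.Walk.isPath_def, SimpleGraph.Walk.support_copy, hq]
    exact hpath g hg
  have heq := (D.isTree.isAcyclic.subsingleton_path _ _).elim ⟨p, hpp⟩ ⟨_, hqp⟩
  have hsup := congrArg (fun r => r.1.support) heq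
  simp only [SimpleGraph.Walk.support_copy, hp, hq] at hsup
  exact List.map_inj_left.1 hsup j (by simp only [List.mem_range'_1]; omega)

/-- The node at time `t` whose bag contains `v`. -/
theorem exists_node : ∃ node : V → ℕ → D.Node, ∀ v t, 1 ≤ t → t ≤ G.lifetime →
    ∀ i, (D.time i = t ∧ v ∈ D.bag i) ↔ i = node v t := by
  classical
  have : ∀ v t, ∃ i, 1 ≤ t → t ≤ G.lifetime →
      ∀ j, (D.time j = t ∧ v ∈ D.bag j) ↔ j = i := by
    intro v t
    by_cases h : 1 ≤ t ∧ t ≤ G.lifetime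
    · obtain ⟨i, hi, hu⟩ := D.vertex_unique v t h.1 h.2
      exact ⟨i, fun _ _ j => ⟨fun hj => hu j hj, fun hj => hj ▸ hi⟩⟩
    · have := D.isTree.connected.nonempty
      exact ⟨Classical.arbitrary _, fun h1 h2 => absurd ⟨h1, h2⟩ h⟩
  choose f hf using this
  exact ⟨f, hf⟩

end TIMDecomposition

section
variable [DecidableEq V] [Finite V] {G : TemporalGraph V}

/-- The bag at time `t + 1` around the current vertex separates the past of a search from its
future.  So a state `(t, v, S)` is determined by `t`, `v`, the vertex where the search began, and
the part of `S` in that bag. -/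
theorem SuffixState.exists_bag (hG : G.HasTimeEdge) (D : G.TIMDecomposition) (t : ℕ)
    (ht : t < G.lifetime) (v : V) : ∃ B : Finset V, B.card ≤ D.width ∧ ∀ S S' : Finset V,
      ∀ x x' : ℕ → V, G.SuffixState t v S' →
      G.Trajectory t G.lifetime x → G.Trajectory t G.lifetime x' → x t = v → x' t = v →
      (∀ u ∈ S, ∃ j, t ≤ j ∧ j ≤ G.lifetime ∧ x j = u) →
      x G.lifetime = x' G.lifetime → S ∩ B ⊆ S' ∩ B → S ⊆ S' := by
  obtain ⟨node, hnode⟩ := D.exists_node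
  have hlab : ∀ {e s}, G.TimeEdge e s → s ≤ G.lifetime := fun h =>
    (G.isGreatest_lifetime hG).2 ⟨_, h⟩
  -- a traveller stays in one bag at each moment
  have hstep : ∀ {a b : ℕ} {x : ℕ → V}, G.Trajectory a b x → b ≤ G.lifetime → ∀ i, a ≤ i → i < b →
      node (x i) (i + 1) = node (x (i + 1)) (i + 1) := by
    intro a b x hx hb i hi hi'
    rcases hx i hi hi' with h | h
    · rw [h]
    · obtain ⟨s, ⟨⟨h1, h2⟩, h3⟩, -⟩ := D.edge_unique _ _ _ h
      rw [← (hnode (x i) (i + 1) (by omega) (hlab h) s).1 ⟨h3, h1⟩,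
        ← (hnode (x (i + 1)) (i + 1) (by omega) (hlab h) s).1 ⟨h3, h2⟩]
  have hvert : ∀ u i, 1 ≤ i → i < G.lifetime → D.tree.Adj (node u i) (node u (i + 1)) := by
    intro u i hi hi'
    have h1 := (hnode u i hi (by omega) _).2 rfl
    have h2 := (hnode u (i + 1) (by omega) (by omega) _).2 rfl
    exact (D.arc_iff _ _).2 ⟨⟨u, h1.2, h2.2⟩, by rw [h1.1, h2.1]⟩
  have harc : ∀ {a b : ℕ} {x : ℕ → V}, G.Trajectory a b x → b ≤ G.lifetime → ∀ i, a ≤ i → 1 ≤ i →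
      i < b → D.tree.Adj (node (x i) i) (node (x (i + 1)) (i + 1)) := by
    intro a b x hx hb i hi h1 hi'
    rw [← hstep hx hb i hi hi']
    exact hvert _ i h1 (by omega)
  refine ⟨D.bag (node v (t + 1)), ?_, ?_⟩
  · let _ := D.fintypeNode
    exact Finset.le_sup (f := fun i => (D.bag i).card) (Finset.mem_univ _)
  intro S S' x x' hS' hx hx' hxt hxt' hSx hend hsub u hu
  by_contra hu'
  obtain ⟨j, htj, hj, hju⟩ := hSx u hu
  have htj' : t < j := by
    refine lt_of_le_of_ne htj fun h => hu' ?_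
    rw [← hju, ← h, hxt]
    exact hS'.mem
  have h0 : node (x (t + 1)) (t + 1) = node (x' (t + 1)) (t + 1) := by
    rw [← hstep hx le_rfl t le_rfl ht, ← hstep hx' le_rfl t le_rfl ht, hxt, hxt']
  have hsame : node (x j) j = node (x' j) j :=
    D.walk_unique (fun i => node (x i) i) (fun i => node (x' i) i) (t + 1) G.lifetime
      (fun i hi hi' => harc hx le_rfl i (by omega) (by omega) hi')
      (fun i hi hi' => harc hx' le_rfl i (by omega) (by omega) hi') h0 (by simp only [hend])
      j htj' hj
  -- the journey that brings `u` to `v`, continued along `x'`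
  obtain ⟨y, hy, hy0, hyt⟩ := (hS'.reachBy ht u hu').exists_trajectory
  let z : ℕ → V := fun i => if i ≤ t then y i else x' i
  have hz : G.Trajectory 0 G.lifetime z := by
    intro i _ hi
    rcases lt_trichotomy i t with h | rfl | h
    · simp only [z, if_pos h.le, if_pos (Nat.succ_le_of_lt h)]
      exact hy i (Nat.zero_le _) h
    · simp only [z, le_refl, if_true, if_neg (Nat.not_succ_le_self i)]
      rw [hyt, ← hxt']
      exact hx' i le_rfl hi
    · simp only [z, if_neg (not_le.2 h), if_neg (show ¬ i + 1 ≤ t by omega)]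
      exact hx' i h.le hi
  have hz0 : z 0 = u := by simp [z, hy0]
  have hzt : z t = v := by simp [z, hyt]
  have hzj : z j = x' j := by simp [z, htj']
  have hmeet : node (z (t + 1)) (t + 1) = node u (t + 1) := by
    refine D.walk_unique (fun i => node (z i) i) (fun i => node u i) 1 j
      (fun i hi hi' => harc hz le_rfl i (by omega) hi (by omega))
      (fun i hi hi' => hvert u i hi (by omega)) ?_ ?_ (t + 1) (by omega) htj'
    · have := hstep hz le_rfl 0 le_rfl (by omega)
      simp only [zero_add] at this
      simp only [← this, hz0]
    · simp only [hzj, ← hsame, hju]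
  rw [← hstep hz le_rfl t (Nat.zero_le _) ht, hzt] at hmeet
  have huB : u ∈ D.bag (node v (t + 1)) := by
    rw [hmeet]
    exact ((hnode u (t + 1) (by omega) (by omega) _).2 rfl).2
  exact hu' (Finset.mem_inter.1 (hsub (Finset.mem_inter.2 ⟨hu, huB⟩))).1

end

/-- The number of states is at most `(Λ + 1) n² 2 ^ φ`. -/
theorem SuffixState.card_le [DecidableEq V] [Fintype V] {G : TemporalGraph V} (hG : G.HasTimeEdge)
    (K : Finset (ℕ × V × Finset V)) (hK : ∀ x ∈ K, G.SuffixState x.1 x.2.1 x.2.2) :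
    K.card ≤ (G.lifetime + 1) * Fintype.card V ^ 2 * 2 ^ G.timWidth := by
  classical
  obtain ⟨D, hD⟩ := G.exists_timDecomposition hG
  rw [← hD]
  let I : Finset (ℕ × V × V) := Finset.range (G.lifetime + 1) ×ˢ Finset.univ
  let A : ℕ × V × V → Finset (ℕ × V × Finset V) := fun p => K.filter fun k =>
    k.1 = p.1 ∧ k.2.1 = p.2.1 ∧ ∃ x, G.Trajectory p.1 G.lifetime x ∧ x p.1 = p.2.1 ∧
      (∀ u ∈ k.2.2, ∃ j, p.1 ≤ j ∧ j ≤ G.lifetime ∧ x j = u) ∧ x G.lifetime = p.2.2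
  have hsub : K ⊆ I.biUnion A := by
    intro k hk
    obtain ⟨x, h1, h2, h3⟩ := (hK k hk).exists_trajectory
    refine Finset.mem_biUnion.2 ⟨(k.1, k.2.1, x G.lifetime), ?_, ?_⟩
    · have := (hK k hk).le_lifetime
      simp only [I, Finset.mem_product, Finset.mem_range, Finset.mem_univ, and_true]
      omega
    · exact Finset.mem_filter.2 ⟨hk, rfl, rfl, x, h1, h2, h3, rfl⟩
  have hA : ∀ p ∈ I, (A p).card ≤ 2 ^ D.width := by
    rintro ⟨t, v, e⟩ hp
    have htL : t < G.lifetime + 1 := by simpa [I] using hp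
    rcases (Nat.lt_succ_iff.1 htL).eq_or_lt with rfl | ht
    · -- at the last time the only state at `v` is `{v}`
      refine le_trans (Finset.card_le_one.2 ?_) Nat.one_le_two_pow
      have : ∀ k ∈ A (G.lifetime, v, e), k = (G.lifetime, v, {v}) := by
        rintro ⟨t', v', S⟩ hk
        obtain ⟨hkK, ht', hv', x, -, h1, h2, -⟩ := Finset.mem_filter.1 hk
        simp only at ht' hv' h1 h2
        subst ht' hv'
        have hmem := (hK _ hkK).mem
        simp only at hmem
        have : S = {v'} := by
          refine Finset.eq_singleton_iff_unique_mem.2 ⟨hmem, fun u hu => ?_⟩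
          obtain ⟨j, h3, h4, rfl⟩ := h2 u hu
          rw [le_antisymm h4 h3, h1]
        rw [this]
      intro a ha b hb
      rw [this a ha, this b hb]
    · obtain ⟨B, hB, huniq⟩ := SuffixState.exists_bag hG D t ht v
      refine le_trans ?_ (Nat.pow_le_pow_right two_pos hB)
      rw [← Finset.card_powerset]
      refine Finset.card_le_card_of_injOn (fun k => k.2.2 ∩ B)
        (fun k _ => Finset.mem_coe.2 (Finset.mem_powerset.2 Finset.inter_subset_right)) ?_
      rintro ⟨t₁, v₁, S₁⟩ h₁ ⟨t₂, v₂, S₂⟩ h₂ heq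
      obtain ⟨hk₁, rfl, rfl, x₁, a₁, b₁, c₁, d₁⟩ := Finset.mem_filter.1 (Finset.mem_coe.1 h₁)
      obtain ⟨hk₂, rfl, rfl, x₂, a₂, b₂, c₂, d₂⟩ := Finset.mem_filter.1 (Finset.mem_coe.1 h₂)
      simp only at *
      have e₁ := huniq S₁ S₂ x₁ x₂ (hK _ hk₂) a₁ a₂ b₁ b₂ c₁ (d₁.trans d₂.symm) heq.subset
      have e₂ := huniq S₂ S₁ x₂ x₁ (hK _ hk₁) a₂ a₁ b₂ b₁ c₂ (d₂.trans d₁.symm) heq.symm.subset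
      rw [e₁.antisymm e₂]
  calc K.card ≤ (I.biUnion A).card := Finset.card_le_card hsub
    _ ≤ I.card * 2 ^ D.width := Finset.card_biUnion_le_card_mul _ _ _ hA
    _ = _ := by simp [I, Finset.card_product, sq]

end TemporalGraph

/-! ### Programs with time bounds -/

namespace RAM

/-- `Runs p T Q s`: started in `s`, the program `p` halts within `T` steps in a store that
satisfies `Q`. -/
def Runs (p : Prog) (T : ℕ) (Q : Store → Prop) (s : Store) : Prop :=
  ∃ t s', Exec p s t s' ∧ t ≤ T ∧ Q s'

/-- The register written by an instruction is `r`. -/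
def Instr.writesReg : Instr → ℕ → Bool
  | .nop, _ => false
  | .const x _, r => x == r
  | .copy x _, r => x == r
  | .add x _ _, r => x == r
  | .sub x _ _, r => x == r
  | .load x _ _, r => x == r
  | .store _ _ _, _ => false

/-- The array written by an instruction is `a`. -/
def Instr.writesArr : Instr → ℕ → Bool
  | .store b _ _, a => b == a
  | _, _ => false

/-- Some instruction of the program writes register `r`. -/
def Prog.writesReg : Prog → ℕ → Bool
  | .instr i, r => i.writesReg r
  | .seq p q, r => p.writesReg r || q.writesReg r
  | .branch _ p q, r => p.writesReg r || q.writesReg r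
  | .loop _ p, r => p.writesReg r

/-- Some instruction of the program writes array `a`. -/
def Prog.writesArr : Prog → ℕ → Bool
  | .instr i, a => i.writesArr a
  | .seq p q, a => p.writesArr a || q.writesArr a
  | .branch _ p q, a => p.writesArr a || q.writesArr a
  | .loop _ p, a => p.writesArr a

/-- The stores `s` and `s'` agree on everything that `p` does not write. -/
structure Frame (p : Prog) (s s' : Store) : Prop where
  reg : ∀ r, p.writesReg r = false → s'.reg r = s.reg r
  arr : ∀ a, p.writesArr a = false → s'.arr a = s.arr a

theorem Frame.refl (p : Prog) (s : Store) : Frame p s s := ⟨fun _ _ => rfl, fun _ _ => rfl⟩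

theorem Frame.trans {p : Prog} {s s₁ s₂ : Store} (h₁ : Frame p s s₁) (h₂ : Frame p s₁ s₂) :
    Frame p s s₂ :=
  ⟨fun r h => (h₂.reg r h).trans (h₁.reg r h), fun a h => (h₂.arr a h).trans (h₁.arr a h)⟩

theorem Frame.seq_left {p q : Prog} {s s' : Store} (h : Frame p s s') : Frame (.seq p q) s s' :=
  ⟨fun r hr => h.reg r (Bool.or_eq_false_iff.1 hr).1,
    fun a ha => h.arr a (Bool.or_eq_false_iff.1 ha).1⟩

theorem Frame.seq_right {p q : Prog} {s s' : Store} (h : Frame q s s') : Frame (.seq p q) s s' :=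
  ⟨fun r hr => h.reg r (Bool.or_eq_false_iff.1 hr).2,
    fun a ha => h.arr a (Bool.or_eq_false_iff.1 ha).2⟩

theorem Frame.instr (i : Instr) (s : Store) : Frame (.instr i) s (i.run s) := by
  constructor
  · intro r hr
    cases i <;> simp only [Prog.writesReg, Instr.writesReg, beq_eq_false_iff_ne, ne_eq] at hr <;>
      simp only [Instr.run]
    all_goals exact Function.update_of_ne (Ne.symm hr) _ _
  · intro a ha
    cases i <;> simp only [Prog.writesArr, Instr.writesArr, beq_eq_false_iff_ne, ne_eq] at ha <;>
      simp only [Instr.run]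
    exact Function.update_of_ne (Ne.symm ha) _ _

theorem Exec.frame {p : Prog} {s s' : Store} {t : ℕ} (h : Exec p s t s') : Frame p s s' := by
  induction h with
  | instr i s => exact .instr i s
  | seq _ _ ih₁ ih₂ => exact ih₁.seq_left.trans ih₂.seq_right
  | branch_true _ _ ih => exact ⟨ih.seq_left.reg, ih.seq_left.arr⟩
  | branch_false _ _ ih => exact ⟨ih.seq_right.reg, ih.seq_right.arr⟩
  | loop_done _ => exact .refl _ _
  | loop_step _ _ _ ih₁ ih₂ => exact Frame.trans ⟨ih₁.reg, ih₁.arr⟩ ih₂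

/-! The following rules are those of Hoare logic, with the frame of a piece of program supplied
for free. -/

theorem Runs.mono {p : Prog} {T T' : ℕ} {Q Q' : Store → Prop} {s : Store} (h : Runs p T Q s)
    (hT : T ≤ T') (hQ : ∀ s', Frame p s s' → Q s' → Q' s') : Runs p T' Q' s := by
  obtain ⟨t, s', he, ht, hs⟩ := h
  exact ⟨t, s', he, ht.trans hT, hQ s' he.frame hs⟩

theorem Runs.seq {p q : Prog} {T₁ T₂ : ℕ} {P Q : Store → Prop} {s : Store}
    (hp : Runs p T₁ P s) (hq : ∀ s', Frame p s s' → P s' → Runs q T₂ Q s') :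
    Runs (.seq p q) (T₁ + T₂) Q s := by
  obtain ⟨t₁, s₁, h₁, ht₁, hP⟩ := hp
  obtain ⟨t₂, s₂, h₂, ht₂, hQ⟩ := hq s₁ h₁.frame hP
  exact ⟨_, s₂, .seq h₁ h₂, Nat.add_le_add ht₁ ht₂, hQ⟩

theorem Runs.branch {b : Test} {p q : Prog} {T : ℕ} {Q : Store → Prop} {s : Store}
    (hp : b.Holds s → Runs p T Q s) (hq : ¬ b.Holds s → Runs q T Q s) :
    Runs (.branch b p q) (T + 1) Q s := by
  by_cases h : b.Holds s
  · obtain ⟨t, s', he, ht, hQ⟩ := hp h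
    exact ⟨_, s', .branch_true h he, Nat.succ_le_succ ht, hQ⟩
  · obtain ⟨t, s', he, ht, hQ⟩ := hq h
    exact ⟨_, s', .branch_false h he, Nat.succ_le_succ ht, hQ⟩

theorem Runs.instr (i : Instr) {Q : Store → Prop} {s : Store} (h : Q (i.run s)) :
    Runs (.instr i) 1 Q s :=
  ⟨1, _, .instr i s, le_rfl, h⟩

/-- The number `k` counts the rounds that have been completed.  That there are at most `N` rounds
may be deduced from the invariant. -/
theorem Runs.loop {b : Test} {p : Prog} {s : Store} (I : ℕ → Store → Prop) (N T : ℕ) (h0 : I 0 s)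
    (hstep : ∀ k s', Frame p s s' → I k s' → b.Holds s' → k < N ∧ Runs p T (I (k + 1)) s') :
    Runs (.loop b p) (N * (T + 1) + 1) (fun s' => ∃ k, I k s' ∧ ¬ b.Holds s') s := by
  suffices H : ∀ d k s', N - k ≤ d → Frame p s s' → I k s' →
      Runs (.loop b p) (d * (T + 1) + 1) (fun s' => ∃ k, I k s' ∧ ¬ b.Holds s') s' from
    H N 0 s (by omega) (.refl _ _) h0
  intro d
  induction d with
  | zero =>
    intro k s' hd hF hI
    by_cases h : b.Holds s'
    · have := (hstep k s' hF hI h).1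
      omega
    · exact ⟨1, s', .loop_done h, by omega, k, hI, h⟩
  | succ d ih =>
    intro k s' hd hF hI
    by_cases h : b.Holds s'
    · obtain ⟨hk, t₁, s₁, h₁, ht₁, hI₁⟩ := hstep k s' hF hI h
      obtain ⟨t₂, s₂, h₂, ht₂, hQ⟩ := ih (k + 1) s₁ (by omega) (hF.trans h₁.frame) hI₁
      refine ⟨_, s₂, .loop_step h h₁ h₂, ?_, hQ⟩
      rw [Nat.succ_mul]
      omega
    · exact ⟨1, s', .loop_done h, by omega, k, hI, h⟩

/-- A list of instructions. -/
def block : List Instr → Prog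
  | [] => .instr .nop
  | i :: l => .seq (.instr i) (block l)

theorem Runs.block (l : List Instr) {Q : Store → Prop} {s : Store}
    (h : ∀ s', s' = l.foldl (fun s i => i.run s) s → Frame (block l) s s' → Q s') :
    Runs (block l) (l.length + 1) Q s := by
  have key : ∀ (l : List Instr) (s : Store),
      Exec (RAM.block l) s (l.length + 1) (l.foldl (fun s i => i.run s) s) := by
    intro l
    induction l with
    | nil => exact fun s => .instr .nop s
    | cons i l ih =>
      intro s
      have := Exec.seq (.instr i s) (ih (i.run s))
      rwa [Nat.add_comm 1] at this
  exact ⟨_, _, key l s, le_rfl, h _ rfl (key l s).frame⟩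

theorem Runs.block_le (l : List Instr) {T : ℕ} {Q : Store → Prop} {s : Store}
    (hT : l.length + 1 ≤ T)
    (h : ∀ s', s' = l.foldl (fun s i => i.run s) s → Frame (RAM.block l) s s' → Q s') :
    Runs (RAM.block l) T Q s :=
  (Runs.block l h).mono hT fun _ _ h => h

theorem Runs.block_seq (l : List Instr) {p : Prog} {T : ℕ} {Q : Store → Prop} {s : Store}
    (h : ∀ s', s' = l.foldl (fun s i => i.run s) s → Frame (RAM.block l) s s' → Runs p T Q s') :
    Runs (.seq (RAM.block l) p) (l.length + 1 + T) Q s :=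
  .seq (P := fun s' => s' = l.foldl (fun s i => i.run s) s) (.block l fun _ h _ => h)
    fun s' hF hs' => h s' hs' hF

/-- For `i = 0, …, n - 1`, where `n` is the content of register `n`.  Register `1` is expected to
contain `1`. -/
def forLoop (i n : ℕ) (body : Prog) : Prog :=
  .seq (.instr (.const i 0)) (.loop (.lt i n) (.seq body (.instr (.add i i 1))))

/-- The invariant `I k` is not to mention the loop variable `i`; this is `hI`. -/
theorem Runs.forLoop {i n : ℕ} {body : Prog} {s : Store} (I : ℕ → Store → Prop) (N T : ℕ)
    (hn : s.reg n = N) (h1 : s.reg 1 = 1)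
    (hI : ∀ k s s', I k s → (∀ r, r ≠ i → s'.reg r = s.reg r) → s'.arr = s.arr → I k s')
    (h0 : I 0 s)
    (hstep : ∀ k s', k < N → Frame (forLoop i n body) s s' → I k s' → s'.reg i = k →
      Runs body T (I (k + 1)) s')
    (hw : (forLoop i n body).writesReg n = false := by rfl)
    (hw1 : (forLoop i n body).writesReg 1 = false := by rfl)
    (hwi : body.writesReg i = false := by rfl) :
    Runs (forLoop i n body) (N * (T + 2) + 2) (I N) s := by
  have hin : i ≠ n := by
    rintro rfl
    simp [RAM.forLoop, Prog.writesReg, Instr.writesReg] at hw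
  refine (Runs.seq (P := fun s' => I 0 s' ∧ s'.reg i = 0) (.instr _ ?_) fun s₁ hF₁ h =>
    (Runs.loop (fun k s' => k ≤ N ∧ I k s' ∧ s'.reg i = k) N (T + 1) ⟨Nat.zero_le _, h.1, h.2⟩
      fun k s₂ hF₂ hk hb => ?_).mono le_rfl ?_).mono (by rw [Nat.add_comm 1]) fun _ _ h => h
  · refine ⟨hI 0 s _ h0 (fun r hr => ?_) rfl, ?_⟩
    · simp [Instr.run, hr]
    · simp [Instr.run]
  · have hF : Frame (RAM.forLoop i n body) s s₂ :=
      Frame.trans hF₁.seq_left (Frame.seq_right ⟨hF₂.reg, hF₂.arr⟩)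
    have hkN : k < N := by
      have h2 : s₂.reg i < s₂.reg n := hb
      rw [hk.2.2, hF.reg n hw, hn] at h2
      exact h2
    refine ⟨hkN, Runs.seq (hstep k s₂ hkN hF hk.2.1 hk.2.2) fun s₃ hF₃ h3 => .instr _ ?_⟩
    have hi : s₃.reg i = k := by rw [hF₃.reg i hwi, hk.2.2]
    have h1' : s₃.reg 1 = 1 := by
      have : body.writesReg 1 = false := by
        simp only [RAM.forLoop, Prog.writesReg, Bool.or_eq_false_iff] at hw1
        exact hw1.2.1
      rw [hF₃.reg 1 this, hF.reg 1 hw1, h1]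
    refine ⟨hkN, hI _ _ _ h3 (fun r hr => ?_) rfl, ?_⟩
    · simp [Instr.run, hr]
    · simp [Instr.run, hi, h1']
  · rintro s₂ hF₂ ⟨k, ⟨hkN, hk, hki⟩, hb⟩
    have hF : Frame (RAM.forLoop i n body) s s₂ :=
      Frame.trans hF₁.seq_left (Frame.seq_right ⟨hF₂.reg, hF₂.arr⟩)
    have h2 : ¬ s₂.reg i < s₂.reg n := hb
    rw [hki, hF.reg n hw, hn] at h2
    rwa [← show k = N by omega]

end RAM

/-! ### The input word and the memory layout -/

theorem List.getElem?_flatMap_of_length {α β : Type*} (f : α → List β) (k : ℕ)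
    (hf : ∀ a, (f a).length = k) (l : List α) (i j : ℕ) (hj : j < k) (a : α) (ha : l[i]? = some a) :
    (l.flatMap f)[i * k + j]? = (f a)[j]? := by
  induction l generalizing i with
  | nil => simp at ha
  | cons b l ih =>
    rw [List.flatMap_cons]
    cases i with
    | zero =>
      obtain rfl : b = a := by simpa using ha
      rw [Nat.zero_mul, Nat.zero_add, List.getElem?_append_left (by rw [hf]; exact hj)]
    | succ i =>
      have h : (i + 1) * k + j = k + (i * k + j) := by ring
      rw [h, List.getElem?_append_right (by rw [hf]; omega), hf, Nat.add_sub_cancel_left]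
      exact ih i (by simpa using ha)

theorem List.length_flatMap_of_length {α β : Type*} (f : α → List β) (k : ℕ)
    (hf : ∀ a, (f a).length = k) (l : List α) : (l.flatMap f).length = l.length * k := by
  simp [List.length_flatMap, hf]

namespace TemporalGraph

variable {n : ℕ} (G : TemporalGraph (Fin n))

open Classical in
/-- The truth value of a proposition, as a number. -/
noncomputable def ind (p : Prop) : ℕ := if p then 1 else 0

theorem ind_true {p : Prop} (h : p) : ind p = 1 := if_pos h

theorem ind_false {p : Prop} (h : ¬ p) : ind p = 0 := if_neg h

theorem ind_eq_one {p : Prop} : ind p = 1 ↔ p := by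
  by_cases h : p <;> simp [ind, h]

theorem ind_eq_zero {p : Prop} : ind p = 0 ↔ ¬ p := by
  by_cases h : p <;> simp [ind, h]

theorem ind_le_one (p : Prop) : ind p ≤ 1 := by
  by_cases h : p <;> simp [ind, h]

theorem ind_congr {p q : Prop} (h : p ↔ q) : ind p = ind q := by
  rw [propext h]

theorem length_encode : G.encode.length = 2 + G.lifetime * (n * n) := by
  rw [encode, List.length_cons, List.length_cons,
    List.length_flatMap_of_length _ (n * n) (fun t => ?_), List.length_range]
  · ring
  · rw [List.length_flatMap_of_length _ n (fun u => by simp), List.length_finRange]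

/-- The place of an entry of the adjacency matrices in the input word. -/
theorem getD_encode (t : ℕ) (ht : t < G.lifetime) (u v : Fin n) :
    G.encode.getD (2 + (t * (n * n) + u * n + v)) 0 = ind (G.TimeEdge s(u, v) (t + 1)) := by
  rw [List.getD_eq_getElem?_getD, encode, Nat.add_comm 2, List.getElem?_cons_succ,
    List.getElem?_cons_succ, Nat.add_assoc]
  have huv : (u : ℕ) * n + v < n * n := by
    have hu := u.2
    have hv := v.2
    have : ((u : ℕ) + 1) * n ≤ n * n := Nat.mul_le_mul_right _ hu
    rw [Nat.succ_mul] at this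
    omega
  rw [List.getElem?_flatMap_of_length _ (n * n) _ _ t _ huv t (by simp [ht]),
    List.getElem?_flatMap_of_length _ n (fun u => by simp) _ u _ v.2 u (by simp)]
  · simp only [List.getElem?_map,
      List.getElem?_eq_getElem (l := List.finRange n) (i := v) (by simp), List.getElem_finRange,
      Option.map_some, Option.getD_some, ind]
    rfl
  · intro t
    rw [List.length_flatMap_of_length _ n (fun u => by simp), List.length_finRange]

/-- The registers that describe the size of the input.  Registers `1`, `7` and `8` hold the
constants `1`, `0` and `2`. -/
structure Sizes (s : Store) : Prop where
  one : s.reg 1 = 1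
  vertices : s.reg 2 = n
  lifetime : s.reg 3 = G.lifetime
  square : s.reg 4 = n * n
  layers : s.reg 5 = G.lifetime * (n * n)
  modulus : s.reg 6 = G.lifetime * (n * n) + n * n
  zero : s.reg 7 = 0
  two : s.reg 8 = 2
  input : ∀ t < G.lifetime, ∀ u v : Fin n,
    s.arr 0 (2 + (t * (n * n) + u * n + v)) = ind (G.TimeEdge s(u, v) (t + 1))

/-- A program does not write the registers `1`, …, `8`, nor the array that holds the input. -/
def _root_.RAM.Prog.KeepsSizes (p : Prog) : Prop :=
  (∀ r < 9, 0 < r → p.writesReg r = false) ∧ p.writesArr 0 = false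

instance (p : Prog) : Decidable p.KeepsSizes := inferInstanceAs (Decidable (_ ∧ _))

variable {G}

theorem Sizes.frame {s s' : Store} (h : G.Sizes s) {p : Prog} (hF : Frame p s s')
    (hp : p.KeepsSizes) : G.Sizes s' := by
  have hr : ∀ r < 9, 0 < r → s'.reg r = s.reg r := fun r h h' => hF.reg r (hp.1 r h h')
  have ha := hF.arr 0 hp.2
  constructor
  · rw [hr 1 (by omega) (by omega), h.one]
  · rw [hr 2 (by omega) (by omega), h.vertices]
  · rw [hr 3 (by omega) (by omega), h.lifetime]
  · rw [hr 4 (by omega) (by omega), h.square]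
  · rw [hr 5 (by omega) (by omega), h.layers]
  · rw [hr 6 (by omega) (by omega), h.modulus]
  · rw [hr 7 (by omega) (by omega), h.zero]
  · rw [hr 8 (by omega) (by omega), h.two]
  · rw [ha]
    exact h.input

/-- The products `n²` and `Λ n²` are computed by repeated addition. -/
def sizesProg : Prog :=
  .seq (block [.const 1 1, .const 8 2, .load 2 0 7, .load 3 0 1])
    (.seq (forLoop 10 2 (block [.add 4 4 2]))
      (.seq (forLoop 10 3 (block [.add 5 5 4])) (block [.add 6 5 4])))

theorem sizesProg_runs : Runs sizesProg (5 + ((n * (2 + 2) + 2) + ((G.lifetime * (2 + 2) + 2) + 2)))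
    (fun s => G.Sizes s ∧ s.reg 0 = 0 ∧ s.reg 30 = 0 ∧ ∀ a, 0 < a → s.arr a = fun _ => 0)
    (init G.encode) := by
  have hn : G.encode.getD 0 0 = n := rfl
  have hL : G.encode.getD 1 0 = G.lifetime := rfl
  refine .block_seq _ fun s₁ h₁ hF₁ => ?_
  have e1 : s₁.reg 1 = 1 := by simp [h₁, Instr.run]
  have e2 : s₁.reg 2 = n := by simp [h₁, Instr.run, init, ← hn]
  have e3 : s₁.reg 3 = G.lifetime := by simp [h₁, Instr.run, init, ← hL]
  refine .seq (.forLoop (fun k s => s.reg 4 = k * n) n 2 e2 e1 ?_ ?_ ?_) fun s₂ hF₂ h₂ => ?_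
  · intro k s s' h hr _
    rw [hr 4 (by decide), h]
  · rw [hF₁.reg 4 rfl, Nat.zero_mul]
    rfl
  · intro k s _ hF h _
    refine .block _ fun s' h' _ => ?_
    simp [h', Instr.run, h, hF.reg 2 rfl, e2, Nat.succ_mul]
  have f3 : s₂.reg 3 = G.lifetime := by rw [hF₂.reg 3 rfl, e3]
  have f1 : s₂.reg 1 = 1 := by rw [hF₂.reg 1 rfl, e1]
  refine .seq (.forLoop (fun k s => s.reg 5 = k * (n * n)) G.lifetime 2 f3 f1 ?_ ?_ ?_)
    fun s₃ hF₃ h₃ => ?_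
  · intro k s s' h hr _
    rw [hr 5 (by decide), h]
  · rw [hF₂.reg 5 rfl, hF₁.reg 5 rfl, Nat.zero_mul]
    rfl
  · intro k s _ hF h _
    refine .block _ fun s' h' _ => ?_
    simp [h', Instr.run, h, hF.reg 4 rfl, h₂, Nat.succ_mul]
  have g4 : s₃.reg 4 = n * n := by rw [hF₃.reg 4 rfl, h₂]
  refine .block _ fun s₄ h₄ hF₄ => ⟨?_, ?_, ?_, ?_⟩
  · constructor
    · rw [hF₄.reg 1 rfl, hF₃.reg 1 rfl, f1]
    · rw [hF₄.reg 2 rfl, hF₃.reg 2 rfl, hF₂.reg 2 rfl, e2]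
    · rw [hF₄.reg 3 rfl, hF₃.reg 3 rfl, f3]
    · rw [hF₄.reg 4 rfl, g4]
    · rw [hF₄.reg 5 rfl, h₃]
    · simp [h₄, Instr.run, h₃, g4]
    · rw [hF₄.reg 7 rfl, hF₃.reg 7 rfl, hF₂.reg 7 rfl, hF₁.reg 7 rfl]
      rfl
    · rw [hF₄.reg 8 rfl, hF₃.reg 8 rfl, hF₂.reg 8 rfl]
      simp [h₁, Instr.run]
    · rw [hF₄.arr 0 rfl, hF₃.arr 0 rfl, hF₂.arr 0 rfl, hF₁.arr 0 rfl]
      exact G.getD_encode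
  · rw [hF₄.reg 0 rfl, hF₃.reg 0 rfl, hF₂.reg 0 rfl, hF₁.reg 0 rfl]
    rfl
  · rw [hF₄.reg 30 rfl, hF₃.reg 30 rfl, hF₂.reg 30 rfl, hF₁.reg 30 rfl]
    rfl
  · intro a ha
    rw [hF₄.arr a rfl, hF₃.arr a rfl, hF₂.arr a rfl, hF₁.arr a rfl]
    simp [init, ha.ne']

end TemporalGraph

/-! ### The tables of powers and of reachability -/

namespace TemporalGraph

variable {n : ℕ} {G : TemporalGraph (Fin n)}

theorem mul_add_inj {m a b c d : ℕ} (hb : b < m) (hd : d < m) (h : a * m + b = c * m + d) :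
    a = c ∧ b = d := by
  have h1 : (a * m + b) / m = a := by
    rw [Nat.mul_comm, Nat.mul_add_div (by omega), Nat.div_eq_of_lt hb, Nat.add_zero]
  have h2 : (c * m + d) / m = c := by
    rw [Nat.mul_comm, Nat.mul_add_div (by omega), Nat.div_eq_of_lt hd, Nat.add_zero]
  have hac : a = c := by rw [← h1, h, h2]
  subst hac
  exact ⟨rfl, Nat.add_left_cancel h⟩

theorem row_add_lt (v u : Fin n) : (v : ℕ) * n + u < n * n := by
  have hu := u.2
  have : ((v : ℕ) + 1) * n ≤ n * n := Nat.mul_le_mul_right _ v.2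
  rw [Nat.succ_mul] at this
  omega

theorem cell_inj {t t' : ℕ} {v v' u u' : Fin n}
    (h : t * (n * n) + v * n + u = t' * (n * n) + v' * n + u') : t = t' ∧ v = v' ∧ u = u' := by
  rw [Nat.add_assoc, Nat.add_assoc] at h
  obtain ⟨h1, h2⟩ := mul_add_inj (row_add_lt v u) (row_add_lt v' u') h
  obtain ⟨h3, h4⟩ := mul_add_inj u.2 u'.2 h2
  exact ⟨h1, Fin.ext h3, Fin.ext h4⟩

/-- Cell `u` of array `8` receives the weight of the vertex `u` in the codes of sets. -/
def powersProg : Prog :=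
  .seq (block [.copy 11 6]) (forLoop 10 2 (block [.store 8 10 11, .add 11 11 11]))

theorem powersProg_runs {s : Store} (h : G.Sizes s) : Runs powersProg (2 + (n * (3 + 2) + 2))
    (fun s => ∀ u < n, s.arr 8 u = (G.lifetime * (n * n) + n * n) * 2 ^ u) s := by
  refine .block_seq _ fun s₁ h₁ hF₁ => ?_
  have hs₁ := h.frame hF₁ (by decide)
  refine (Runs.forLoop (fun k s => s.reg 11 = (G.lifetime * (n * n) + n * n) * 2 ^ k ∧
    ∀ u < k, s.arr 8 u = (G.lifetime * (n * n) + n * n) * 2 ^ u) n 3 hs₁.vertices hs₁.one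
    ?_ ?_ ?_).mono le_rfl fun _ _ h => h.2
  · intro k s s' h hr ha
    rw [hr 11 (by decide), ha]
    exact h
  · refine ⟨?_, fun u hu => absurd hu (Nat.not_lt_zero u)⟩
    simp [h₁, Instr.run, h.modulus]
  · intro k s _ hF h hk
    refine .block _ fun s' h' _ => ⟨?_, fun u hu => ?_⟩
    · simp only [h', List.foldl_cons, List.foldl_nil, Instr.run, Function.update_self, h.1]
      ring
    · simp only [h', List.foldl_cons, List.foldl_nil, Instr.run, Function.update_self, h.1, hk]
      rcases Nat.lt_succ_iff_lt_or_eq.1 hu with hu | rfl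
      · rw [Function.update_of_ne hu.ne, h.2 u hu]
      · rw [Function.update_self]

/-- `ReachBy 0` is equality: the first layer of the table is a unit matrix. -/
def diagProg : Prog :=
  .seq (block [.const 11 0])
    (forLoop 10 2 (block [.store 1 11 1, .add 11 11 2, .add 11 11 1]))

theorem diagProg_runs {s : Store} (h : G.Sizes s) (h0 : ∀ a, s.arr 1 a = 0) :
    Runs diagProg (2 + (n * (4 + 2) + 2))
      (fun s => ∀ v u : Fin n, s.arr 1 (v * n + u) = ind (v = u)) s := by
  refine .block_seq _ fun s₁ h₁ hF₁ => ?_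
  have hs₁ := h.frame hF₁ (by decide)
  refine (Runs.forLoop (fun k s => s.reg 11 = k * n + k ∧
    ∀ v u : Fin n, s.arr 1 (v * n + u) = ind (v = u ∧ v < k)) n 4 hs₁.vertices hs₁.one
    ?_ ?_ ?_).mono le_rfl fun _ _ h v u => ?_
  · intro k s s' h hr ha
    rw [hr 11 (by decide), ha]
    exact h
  · refine ⟨?_, fun v u => ?_⟩
    · simp [h₁, Instr.run]
    · rw [hF₁.arr 1 rfl, h0, ind_false (fun h => Nat.not_lt_zero _ h.2)]
  · intro k s hkn hF h hk
    have hsz := hs₁.frame hF (by decide)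
    refine .block _ fun s' h' _ => ⟨?_, fun v u => ?_⟩
    · simp [h', Instr.run, h.1, hsz.vertices, hsz.one]
      ring
    · simp only [h', List.foldl_cons, List.foldl_nil, Instr.run, Function.update_self, h.1,
        hsz.one]
      by_cases hvu : (v : ℕ) * n + u = k * n + k
      · obtain ⟨h1, h2⟩ := mul_add_inj u.2 hkn hvu
        rw [hvu, Function.update_self, ind_true ⟨Fin.ext (by omega), by omega⟩]
      · rw [Function.update_of_ne hvu, h.2]
        refine ind_congr (and_congr_right fun hv => ⟨fun h => by omega, fun h => ?_⟩)
        subst hv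
        have : (v : ℕ) ≠ k := fun h => hvu (by rw [h])
        omega
  · rw [h.2]
    exact ind_congr (and_iff_left v.2)

/-- The cells of the reachability table with addresses less than `k` are correct. -/
def Filled (G : TemporalGraph (Fin n)) (k : ℕ) (s : Store) : Prop :=
  ∀ t ≤ G.lifetime, ∀ v u : Fin n, t * (n * n) + v * n + u < k →
    s.arr 1 (t * (n * n) + v * n + u) = ind (G.ReachBy t v u)

/-- One cell of the reachability table is computed from the previous layer: register `12` holds
the address of the layer, `13` that of the row, `15` the column and `21` the address of the
corresponding row of the input. -/
def cellProg : Prog :=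
  .seq (block [.add 16 13 15, .load 17 1 16, .add 18 12 15, .copy 22 21])
    (.seq (forLoop 19 2
      (.seq (block [.load 20 1 18, .load 23 0 22, .add 24 20 23])
        (.seq (.branch (.eq 24 8) (block [.const 17 1]) (block []))
          (block [.add 18 18 2, .add 22 22 1]))))
      (block [.add 16 16 4, .store 1 16 17]))

theorem cellProg_runs {s : Store} (h : G.Sizes s) (t : ℕ) (ht : t < G.lifetime) (v u : Fin n)
    (hfill : G.Filled (n * n + (t * (n * n) + v * n + u)) s) (h12 : s.reg 12 = t * (n * n))
    (h13 : s.reg 13 = t * (n * n) + v * n) (h15 : s.reg 15 = u)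
    (h21 : s.reg 21 = t * (n * n) + v * n + 2) :
    Runs cellProg (5 + (n * (4 + (2 + 1 + 3) + 2) + 2 + 3))
      (G.Filled (n * n + (t * (n * n) + v * n + (u + 1)))) s := by
  refine .block_seq _ fun s₁ h₁ hF₁ => ?_
  have hs₁ := h.frame hF₁ (by decide)
  have e16 : s₁.reg 16 = t * (n * n) + v * n + u := by simp [h₁, Instr.run, h13, h15]
  have e17 : s₁.reg 17 = ind (G.ReachBy t v u) := by
    simp only [h₁, List.foldl_cons, List.foldl_nil, Instr.run]
    simp only [Function.update_apply, h13, h15]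
    simpa using hfill t ht.le v u (by have := row_add_lt v u; omega)
  have e18 : s₁.reg 18 = t * (n * n) + u := by simp [h₁, Instr.run, h12, h15]
  have e22 : s₁.reg 22 = t * (n * n) + v * n + 2 := by simp [h₁, Instr.run, h21]
  have hfill₁ : G.Filled (n * n + (t * (n * n) + v * n + u)) s₁ := by
    rw [Filled, hF₁.arr 1 rfl]
    exact hfill
  refine .seq (.forLoop (fun k s =>
    s.reg 17 = ind (G.ReachBy t v u ∨
      ∃ w : Fin n, (w : ℕ) < k ∧ G.TimeEdge s(v, w) (t + 1) ∧ G.ReachBy t w u) ∧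
    s.reg 18 = t * (n * n) + k * n + u ∧ s.reg 22 = 2 + (t * (n * n) + v * n + k))
    n _ hs₁.vertices hs₁.one ?_ ?_ ?_) fun s₂ hF₂ h₂ => ?_
  · intro k s s' h hr _
    rw [hr 17 (by decide), hr 18 (by decide), hr 22 (by decide)]
    exact h
  · refine ⟨?_, ?_, ?_⟩
    · rw [e17]
      exact ind_congr ⟨Or.inl, fun h => h.elim id fun ⟨w, hw, _⟩ => absurd hw (Nat.not_lt_zero _)⟩
    · rw [e18]
      ring
    · rw [e22]
      ring
  · rintro k s hk hF ⟨h17, h18, h22⟩ -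
    have hs := hs₁.frame hF (by decide)
    have harr : s.arr 1 (t * (n * n) + k * n + u) = ind (G.ReachBy t ⟨k, hk⟩ u) := by
      rw [hF.arr 1 rfl]
      refine hfill₁ t ht.le ⟨k, hk⟩ u ?_
      have := row_add_lt ⟨k, hk⟩ u
      simp only at this ⊢
      omega
    have hinp : s.arr 0 (2 + (t * (n * n) + v * n + k)) = ind (G.TimeEdge s(v, ⟨k, hk⟩) (t + 1)) :=
      hs.input t ht v ⟨k, hk⟩
    refine .block_seq _ fun s₃ h₃ hF₃ => ?_
    have e24 : s₃.reg 24 = ind (G.ReachBy t ⟨k, hk⟩ u) +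
        ind (G.TimeEdge s(v, ⟨k, hk⟩) (t + 1)) := by
      rw [← harr, ← hinp, ← h18, ← h22]
      simp [h₃, Instr.run]
    have hs₃ := hs.frame hF₃ (by decide)
    have hsucc : (G.ReachBy t v u ∨
        ∃ w : Fin n, (w : ℕ) < k + 1 ∧ G.TimeEdge s(v, w) (t + 1) ∧ G.ReachBy t w u) ↔
        (G.ReachBy t v u ∨
          ∃ w : Fin n, (w : ℕ) < k ∧ G.TimeEdge s(v, w) (t + 1) ∧ G.ReachBy t w u) ∨
        (G.TimeEdge s(v, ⟨k, hk⟩) (t + 1) ∧ G.ReachBy t ⟨k, hk⟩ u) := by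
      rw [or_assoc]
      refine or_congr_right ⟨?_, ?_⟩
      · rintro ⟨w, hw, h⟩
        rcases Nat.lt_succ_iff_lt_or_eq.1 hw with hw | hw
        · exact Or.inl ⟨w, hw, h⟩
        · obtain rfl : w = ⟨k, hk⟩ := Fin.ext hw
          exact Or.inr h
      · rintro (⟨w, hw, h⟩ | h)
        · exact ⟨w, by omega, h⟩
        · exact ⟨⟨k, hk⟩, by simp, h⟩
    refine .seq (P := fun s' => s'.reg 17 = ind (G.ReachBy t v u ∨
      ∃ w : Fin n, (w : ℕ) < k + 1 ∧ G.TimeEdge s(v, w) (t + 1) ∧ G.ReachBy t w u))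
      (.branch (T := 2) (fun hb => .block _ fun s' h' _ => ?_)
        fun hb => .block_le _ (by decide) fun s' h' _ => ?_)
      fun s₄ hF₄ h₄ => .block _ fun s₅ h₅ hF₅ => ⟨?_, ?_, ?_⟩
    · simp only [Test.Holds, hs₃.two, e24] at hb
      have a1 := ind_le_one (G.ReachBy t ⟨k, hk⟩ u)
      have a2 := ind_le_one (G.TimeEdge s(v, ⟨k, hk⟩) (t + 1))
      rw [ind_true (hsucc.2 (Or.inr ⟨ind_eq_one.1 (by omega), ind_eq_one.1 (by omega)⟩))]
      simp [h', Instr.run]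
    · have h17' : s'.reg 17 = s.reg 17 := by
        rw [h', ← hF₃.reg 17 rfl]
        rfl
      rw [h17', h17]
      refine ind_congr ⟨fun h => hsucc.2 (Or.inl h), fun h => (hsucc.1 h).resolve_right ?_⟩
      rintro ⟨a1, a2⟩
      apply hb
      simp only [Test.Holds, hs₃.two, e24, ind_true a1, ind_true a2]
    · rw [hF₅.reg 17 rfl, h₄]
    · have := hF₄.reg 18 rfl
      have h2 := hF₄.reg 2 rfl
      simp [h₅, Instr.run, this, hF₃.reg 18 rfl, h18, h2, hs₃.vertices]
      ring
    · have := hF₄.reg 22 rfl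
      have h2 := hF₄.reg 1 rfl
      simp [h₅, Instr.run, this, hF₃.reg 22 rfl, h22, h2, hs₃.one]
      ring
  · refine .block _ fun s₃ h₃ hF₃ t' ht' v' u' hlt => ?_
    have e17' : s₂.reg 17 = ind (G.ReachBy (t + 1) v u) := by
      rw [h₂.1]
      refine ind_congr (or_congr_right ⟨?_, ?_⟩)
      · rintro ⟨w, -, h⟩
        exact ⟨w, h⟩
      · rintro ⟨w, h⟩
        exact ⟨w, w.2, h⟩
    have e16' : s₂.reg 16 + s₂.reg 4 = (t + 1) * (n * n) + v * n + u := by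
      rw [hF₂.reg 16 rfl, e16, hF₂.reg 4 rfl, hs₁.square]
      ring
    have hs3 : s₃.arr 1 = Function.update (s₂.arr 1) ((t + 1) * (n * n) + v * n + u)
        (ind (G.ReachBy (t + 1) v u)) := by
      rw [← e16', ← e17']
      simp [h₃, Instr.run]
    rw [hs3]
    -- the cell just written is `(t + 1, v, u)`, the first one with an address beyond the old bound
    by_cases heq : t' * (n * n) + v' * n + u' = (t + 1) * (n * n) + v * n + u
    · rw [heq, Function.update_self]
      obtain ⟨rfl, rfl, rfl⟩ := cell_inj heq
      rfl
    · rw [Function.update_of_ne heq, hF₂.arr 1 rfl]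
      refine hfill₁ t' ht' v' u' ?_
      rw [Nat.succ_mul] at heq
      omega

/-- The layers of the reachability table are filled in the order of their addresses. -/
def reachProg : Prog :=
  .seq (block [.const 12 0])
    (forLoop 10 3
      (.seq (block [.copy 13 12])
        (.seq (forLoop 14 2
          (.seq (block [.add 21 13 8]) (.seq (forLoop 15 2 cellProg) (block [.add 13 13 2]))))
          (block [.add 12 12 4]))))

theorem reachProg_runs {s : Store} (h : G.Sizes s)
    (h0 : ∀ v u : Fin n, s.arr 1 (v * n + u) = ind (v = u)) :
    Runs reachProg (2 + (G.lifetime * (2 + (n * (2 + (n * (5 + (n * 12 + 2 + 3) + 2) + 2 + 2) + 2)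
      + 2 + 2) + 2) + 2)) (G.Filled (G.lifetime * (n * n) + n * n)) s := by
  refine .block_seq _ fun s₁ h₁ hF₁ => ?_
  have hs₁ := h.frame hF₁ (by decide)
  refine (Runs.forLoop (fun t s => s.reg 12 = t * (n * n) ∧ G.Filled (n * n + t * (n * n)) s)
    G.lifetime _ hs₁.lifetime hs₁.one ?_ ?_ ?_).mono le_rfl fun s _ h => ?_
  · intro k s s' h hr ha
    rw [hr 12 (by decide), Filled, ha]
    exact h
  · refine ⟨by simp [h₁, Instr.run], ?_⟩
    rintro t - v u hlt
    obtain rfl : t = 0 := by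
      by_contra ht
      have : 1 * (n * n) ≤ t * (n * n) := Nat.mul_le_mul_right _ (Nat.pos_of_ne_zero ht)
      omega
    rw [Nat.zero_mul, Nat.zero_add, hF₁.arr 1 rfl, h0]
    rfl
  · rintro t s ht hF ⟨h12, hfill⟩ -
    have hs := hs₁.frame hF (by decide)
    refine .block_seq _ fun s₂ h₂ hF₂ => ?_
    have hs₂ := hs.frame hF₂ (by decide)
    have e12 : s₂.reg 12 = t * (n * n) := by rw [hF₂.reg 12 rfl, h12]
    refine .seq (.forLoop (fun v s => s.reg 13 = t * (n * n) + v * n ∧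
      G.Filled (n * n + (t * (n * n) + v * n)) s) n _ hs₂.vertices hs₂.one ?_ ?_ ?_)
      fun s₃ hF₃ h₃ => .block _ fun s₄ h₄ hF₄ => ⟨?_, ?_⟩
    · intro k s s' h hr ha
      rw [hr 13 (by decide), Filled, ha]
      exact h
    · refine ⟨by simp [h₂, Instr.run, h12], ?_⟩
      rw [Filled, hF₂.arr 1 rfl, Nat.zero_mul, Nat.add_zero]
      exact hfill
    · rintro v s hv hF₅ ⟨h13, hfill⟩ -
      have hs := hs₂.frame hF₅ (by decide)
      refine .block_seq _ fun s₃ h₃ hF₃ => ?_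
      have hs₃ := hs.frame hF₃ (by decide)
      have e13 : s₃.reg 13 = t * (n * n) + v * n := by rw [hF₃.reg 13 rfl, h13]
      refine .seq (.forLoop (fun u s => G.Filled (n * n + (t * (n * n) + v * n + u)) s)
        n _ hs₃.vertices hs₃.one ?_ ?_ ?_) fun s₄ hF₄ h₄ => .block _ fun s₆ h₆ hF₆ => ⟨?_, ?_⟩
      · intro k s s' h hr ha
        rw [Filled, ha]
        exact h
      · rw [Filled, hF₃.arr 1 rfl]
        exact hfill
      · intro u s' hu hF hfill h15
        have hs' := hs₃.frame hF (by decide)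
        refine (cellProg_runs hs' t ht ⟨v, hv⟩ ⟨u, hu⟩ hfill ?_ ?_ h15 ?_)
        · rw [hF.reg 12 rfl, hF₃.reg 12 rfl, hF₅.reg 12 rfl, e12]
        · rw [hF.reg 13 rfl, e13]
        · rw [hF.reg 21 rfl]
          simp [h₃, Instr.run, h13, hs.two]
      · have e2 : s₄.reg 2 = n := by rw [hF₄.reg 2 rfl, hs₃.vertices]
        simp [h₆, Instr.run, hF₄.reg 13 rfl, e13, e2]
        ring
      · rw [Filled, hF₆.arr 1 rfl, Nat.succ_mul, ← Nat.add_assoc (t * (n * n))]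
        exact h₄
    · have e4 : s₃.reg 4 = n * n := by rw [hF₃.reg 4 rfl, hs₂.square]
      simp [h₄, Instr.run, hF₃.reg 12 rfl, e12, e4]
      ring
    · rw [Filled, hF₄.arr 1 rfl, Nat.succ_mul]
      exact h₃.2
  · rw [Nat.add_comm]
    exact h.2

end TemporalGraph

/-! ### The search -/

namespace TemporalGraph

variable {n : ℕ} (G : TemporalGraph (Fin n))

/-- The code of a set of vertices.  Codes are multiples of a number that exceeds all positions in
the table of pairs of a time and a vertex, so that a code plus such a position determines both. -/
noncomputable def code (S : Finset (Fin n)) : ℕ :=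
  (G.lifetime * (n * n) + n * n) * ∑ u ∈ S, 2 ^ (u : ℕ)

variable {G}

theorem code_insert {S : Finset (Fin n)} {w : Fin n} (hw : w ∉ S) :
    G.code (insert w S) = G.code S + (G.lifetime * (n * n) + n * n) * 2 ^ (w : ℕ) := by
  rw [code, code, Finset.sum_insert hw]
  ring

theorem code_inj {S S' : Finset (Fin n)} {r r' : ℕ} (hr : r < G.lifetime * (n * n) + n * n)
    (hr' : r' < G.lifetime * (n * n) + n * n) (h : G.code S + r = G.code S' + r') :
    S = S' ∧ r = r' := by
  rw [code, code, Nat.mul_comm, Nat.mul_comm _ (∑ u ∈ S', _)] at h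
  obtain ⟨h1, h2⟩ := mul_add_inj hr hr' h
  refine ⟨?_, h2⟩
  have h3 : ∀ S : Finset (Fin n), ∑ u ∈ S, 2 ^ (u : ℕ) = ∑ i ∈ S.map Fin.valEmbedding, 2 ^ i := by
    intro S
    rw [Finset.sum_map]
    rfl
  rw [h3, h3] at h1
  exact Finset.map_injective _ (Finset.geomSum_injective le_rfl h1)

theorem place_lt {t : ℕ} (ht : t ≤ G.lifetime) (v : Fin n) :
    t * (n * n) + v * n < G.lifetime * (n * n) + n * n := by
  have h1 : t * (n * n) ≤ G.lifetime * (n * n) := Nat.mul_le_mul_right _ ht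
  have h2 := row_add_lt v ⟨0, v.pos⟩
  simp only at h2
  omega

theorem vert_lt (v : Fin n) : (v : ℕ) < G.lifetime * (n * n) + n * n := by
  have h2 := row_add_lt ⟨0, v.pos⟩ v
  simp only at h2
  omega

theorem place_inj {t t' : ℕ} {v v' : Fin n} (h : t * (n * n) + v * n = t' * (n * n) + v' * n) :
    t = t' ∧ v = v' := by
  have := cell_inj (u := ⟨0, v.pos⟩) (u' := ⟨0, v.pos⟩) (congrArg (· + 0) h)
  exact ⟨this.1, this.2.1⟩

variable (G)

/-- The data of the search that do not change. -/
structure Tables (s : Store) : Prop extends G.Sizes s where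
  powers : ∀ u : Fin n, s.arr 8 u = (G.lifetime * (n * n) + n * n) * 2 ^ (u : ℕ)
  reach : ∀ t ≤ G.lifetime, ∀ v u : Fin n,
    s.arr 1 (t * (n * n) + v * n + u) = ind (G.ReachBy t v u)

/-- A program does not write the data of `Tables`. -/
def _root_.RAM.Prog.KeepsTables (p : Prog) : Prop :=
  p.KeepsSizes ∧ p.writesArr 1 = false ∧ p.writesArr 8 = false

instance (p : Prog) : Decidable p.KeepsTables := inferInstanceAs (Decidable (_ ∧ _))

/-- The indicator function of `S` stands in array `5` behind the code of `S`. -/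
def Stored (S : Finset (Fin n)) (s : Store) : Prop :=
  ∀ u : Fin n, s.arr 5 (G.code S + u) = ind (u ∈ S)

/-- The memory represents the list `L` of states found so far: register `30` holds its length, the
arrays `2`, `3` and `4` hold its entries, and array `6` its indicator function. -/
structure Represents (L : List (ℕ × Fin n × Finset (Fin n))) (s : Store) : Prop where
  nodup : L.Nodup
  sound : ∀ x ∈ L, G.SuffixState x.1 x.2.1 x.2.2
  length : s.reg 30 = L.length
  time : ∀ i (h : i < L.length), s.arr 2 i = L[i].1 * (n * n)
  vertex : ∀ i (h : i < L.length), s.arr 3 i = L[i].2.1 * n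
  set : ∀ i (h : i < L.length), s.arr 4 i = G.code L[i].2.2
  stored : ∀ x ∈ L, G.Stored x.2.2 s
  found : ∀ t ≤ G.lifetime, ∀ (v : Fin n) (S : Finset (Fin n)),
    s.arr 6 (G.code S + (t * (n * n) + v * n)) = ind ((t, v, S) ∈ L)

variable {G}

theorem Tables.frame {s s' : Store} (h : G.Tables s) {p : Prog} (hF : Frame p s s')
    (hp : p.KeepsTables) : G.Tables s' where
  toSizes := h.toSizes.frame hF hp.1
  powers := by
    rw [hF.arr 8 hp.2.2]
    exact h.powers
  reach := by
    rw [hF.arr 1 hp.2.1]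
    exact h.reach

theorem Represents.congr {L : List (ℕ × Fin n × Finset (Fin n))} {s s' : Store}
    (h : G.Represents L s) (h30 : s'.reg 30 = s.reg 30) (h2 : s'.arr 2 = s.arr 2)
    (h3 : s'.arr 3 = s.arr 3) (h4 : s'.arr 4 = s.arr 4) (h6 : s'.arr 6 = s.arr 6)
    (h5 : ∀ S, G.Stored S s → G.Stored S s') : G.Represents L s' where
  nodup := h.nodup
  sound := h.sound
  length := h30.trans h.length
  time := by rw [h2]; exact h.time
  vertex := by rw [h3]; exact h.vertex
  set := by rw [h4]; exact h.set
  stored := fun x hx => h5 _ (h.stored x hx)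
  found := by rw [h6]; exact h.found

/-- A program does not write the data of `Represents`. -/
def _root_.RAM.Prog.KeepsList (p : Prog) : Prop :=
  p.writesReg 30 = false ∧ ∀ a ∈ [2, 3, 4, 5, 6], p.writesArr a = false

instance (p : Prog) : Decidable p.KeepsList := inferInstanceAs (Decidable (_ ∧ _))

theorem Represents.frame {L : List (ℕ × Fin n × Finset (Fin n))} {s s' : Store}
    (h : G.Represents L s) {p : Prog} (hF : Frame p s s') (hp : p.KeepsList) :
    G.Represents L s' := by
  refine h.congr (hF.reg 30 hp.1) (hF.arr 2 (hp.2 2 ?_)) (hF.arr 3 (hp.2 3 ?_))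
    (hF.arr 4 (hp.2 4 ?_)) (hF.arr 6 (hp.2 6 ?_)) fun S hS => ?_
  any_goals decide
  rw [Stored, hF.arr 5 (hp.2 5 (by decide))]
  exact hS

/-- A correct entry for one set never spoils the entries for another, even if the cell has been
written before. -/
theorem Stored.update {S T : Finset (Fin n)} {s s' : Store} (hT : G.Stored T s) (u : Fin n)
    (h : s'.arr 5 = Function.update (s.arr 5) (G.code S + u) (ind (u ∈ S))) : G.Stored T s' := by
  intro v
  rw [h]
  by_cases hv : G.code T + v = G.code S + u
  · obtain ⟨rfl, huv⟩ := code_inj (vert_lt v) (vert_lt u) hv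
    rw [hv, Function.update_self, Fin.ext huv]
  · rw [Function.update_of_ne hv, hT]

/-- The program that appends a state to the list: registers `13`, `15` and `19` hold its time,
vertex and set, and register `27` its position in array `6`. -/
def pushProg : Prog :=
  block [.store 6 27 1, .store 2 30 13, .store 3 30 15, .store 4 30 19, .add 30 30 1]

theorem getElem_append_singleton_cases {α : Type*} {P : ℕ → α → Prop} {L : List α} {x : α}
    (hL : ∀ i (h : i < L.length), P i L[i]) (hx : P L.length x) :
    ∀ i (h : i < (L ++ [x]).length), P i (L ++ [x])[i] := by
  intro i h
  by_cases hi : i < L.length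
  · rw [List.getElem_append_left hi]
    exact hL i hi
  · have : i = L.length := by
      rw [List.length_append, List.length_singleton] at h
      omega
    subst this
    simpa using hx

theorem pushProg_runs {s : Store} {L : List (ℕ × Fin n × Finset (Fin n))} (h : G.Tables s)
    (hL : G.Represents L s) {t : ℕ} {v : Fin n} {S : Finset (Fin n)} (hS : G.Stored S s)
    (hnew : (t, v, S) ∉ L) (hsound : G.SuffixState t v S) (h13 : s.reg 13 = t * (n * n))
    (h15 : s.reg 15 = v * n) (h19 : s.reg 19 = G.code S)
    (h27 : s.reg 27 = G.code S + (t * (n * n) + v * n)) :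
    Runs pushProg 6 (G.Represents (L ++ [(t, v, S)])) s := by
  refine .block _ fun s' h' hF => ?_
  have hlen := hL.length
  have a2 : s'.arr 2 = Function.update (s.arr 2) L.length (t * (n * n)) := by
    simp [h', Instr.run, hlen, h13]
  have a3 : s'.arr 3 = Function.update (s.arr 3) L.length (v * n) := by
    simp [h', Instr.run, hlen, h15]
  have a4 : s'.arr 4 = Function.update (s.arr 4) L.length (G.code S) := by
    simp [h', Instr.run, hlen, h19]
  have a6 : s'.arr 6 = Function.update (s.arr 6) (G.code S + (t * (n * n) + v * n)) 1 := by
    simp [h', Instr.run, h27, h.one]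
  have a5 := hF.arr 5 rfl
  constructor
  · rw [List.nodup_append]
    refine ⟨hL.nodup, List.nodup_singleton _, fun a ha b hb hab => ?_⟩
    rw [List.mem_singleton] at hb
    exact hnew (hb ▸ hab ▸ ha)
  · intro x hx
    rcases List.mem_append.1 hx with hx | hx
    · exact hL.sound x hx
    · rw [List.mem_singleton.1 hx]
      exact hsound
  · simp [h', Instr.run, hlen, h.one]
  · refine getElem_append_singleton_cases
      (P := fun i (x : ℕ × Fin n × Finset (Fin n)) => s'.arr 2 i = x.1 * (n * n))
      (fun i hi => ?_) ?_
    · rw [a2, Function.update_of_ne hi.ne, hL.time i hi]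
    · rw [a2, Function.update_self]
  · refine getElem_append_singleton_cases
      (P := fun i (x : ℕ × Fin n × Finset (Fin n)) => s'.arr 3 i = x.2.1 * n)
      (fun i hi => ?_) ?_
    · rw [a3, Function.update_of_ne hi.ne, hL.vertex i hi]
    · rw [a3, Function.update_self]
  · refine getElem_append_singleton_cases
      (P := fun i (x : ℕ × Fin n × Finset (Fin n)) => s'.arr 4 i = G.code x.2.2)
      (fun i hi => ?_) ?_
    · rw [a4, Function.update_of_ne hi.ne, hL.set i hi]
    · rw [a4, Function.update_self]
  · intro x hx
    rw [Stored, a5]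
    rcases List.mem_append.1 hx with hx | hx
    · exact hL.stored x hx
    · rw [List.mem_singleton.1 hx]
      exact hS
  · intro t' ht' v' S'
    rw [a6]
    by_cases heq : G.code S' + (t' * (n * n) + v' * n) = G.code S + (t * (n * n) + v * n)
    · obtain ⟨rfl, h1⟩ := code_inj (place_lt ht' v') (place_lt hsound.le_lifetime v) heq
      obtain ⟨rfl, rfl⟩ := place_inj h1
      rw [Function.update_self, ind_true (by simp)]
    · rw [Function.update_of_ne heq, hL.found t' ht']
      refine ind_congr ?_
      rw [List.mem_append, List.mem_singleton]
      refine ⟨Or.inl, fun h => h.resolve_right fun h => heq ?_⟩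
      simp only [Prod.mk.injEq] at h
      rw [h.1, h.2.1, h.2.2]

/-- The list is filled with the initial states `(Λ, v, {v})`. -/
def initProg : Prog :=
  .seq (block [.copy 13 5, .const 15 0])
    (forLoop 16 2
      (.seq (block [.load 19 8 16, .add 24 19 16, .store 5 24 1, .add 27 19 13, .add 27 27 15])
        (.seq pushProg (block [.add 15 15 2]))))

theorem initProg_runs {s : Store} (h : G.Tables s) (h30 : s.reg 30 = 0)
    (h5 : ∀ a, s.arr 5 a = 0) (h6 : ∀ a, s.arr 6 a = 0) :
    Runs initProg (3 + (n * (6 + (6 + 2) + 2) + 2))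
      (fun s => ∃ L, G.Represents L s ∧ ∀ v, (G.lifetime, v, {v}) ∈ L) s := by
  refine .block_seq _ fun s₁ h₁ hF₁ => ?_
  have hs₁ := h.frame hF₁ (by decide)
  have e13 : s₁.reg 13 = G.lifetime * (n * n) := by simp [h₁, Instr.run, h.layers]
  refine (Runs.forLoop (fun k s => s.reg 15 = k * n ∧
    (∀ (v u : Fin n), k ≤ v → s.arr 5 (G.code {v} + u) = 0) ∧
    ∃ L, G.Represents L s ∧ (∀ v : Fin n, v < k → (G.lifetime, v, {v}) ∈ L) ∧
      (∀ x ∈ L, x.2.1 < k)) n _ hs₁.vertices hs₁.one ?_ ?_ ?_).mono le_rfl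
    fun s _ ⟨_, _, L, hL, h, _⟩ => ⟨L, hL, fun v => h v v.2⟩
  · rintro k s s' ⟨h1, h2, L, h3, h4⟩ hr ha
    refine ⟨by rw [hr 15 (by decide), h1], by rw [ha]; exact h2, L, ?_, h4⟩
    refine h3.congr (hr 30 (by decide)) (by rw [ha]) (by rw [ha]) (by rw [ha]) (by rw [ha])
      fun S hS => ?_
    rw [Stored, ha]
    exact hS
  · refine ⟨by simp [h₁, Instr.run], fun v u _ => by rw [hF₁.arr 5 rfl, h5], [], ?_,
      fun v hv => absurd hv (Nat.not_lt_zero _), fun x hx => absurd hx List.not_mem_nil⟩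
    constructor
    · exact List.nodup_nil
    · exact fun x hx => absurd hx List.not_mem_nil
    · rw [hF₁.reg 30 rfl, h30]
      rfl
    · exact fun i hi => absurd hi (Nat.not_lt_zero _)
    · exact fun i hi => absurd hi (Nat.not_lt_zero _)
    · exact fun i hi => absurd hi (Nat.not_lt_zero _)
    · exact fun x hx => absurd hx List.not_mem_nil
    · intro t _ v S
      rw [hF₁.arr 6 rfl, h6, ind_false List.not_mem_nil]
  · rintro k s hk hF ⟨h15, hzero, L, hL, hall, hlt⟩ h16
    have hs := hs₁.frame hF (by decide)
    have hcode : G.code {⟨k, hk⟩} = (G.lifetime * (n * n) + n * n) * 2 ^ k := by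
      simp [code]
    have hpow := hs.powers ⟨k, hk⟩
    rw [← hcode] at hpow
    simp only at hpow
    refine .block_seq _ fun s₂ h₂ hF₂ => ?_
    have hs₂ := hs.frame hF₂ (by decide)
    have a5 : s₂.arr 5 = Function.update (s.arr 5) (G.code {⟨k, hk⟩} + (⟨k, hk⟩ : Fin n))
        (ind ((⟨k, hk⟩ : Fin n) ∈ ({⟨k, hk⟩} : Finset (Fin n)))) := by
      rw [ind_true (Finset.mem_singleton_self _)]
      simp [h₂, Instr.run, h16, hpow, hs.one]
    have e19 : s₂.reg 19 = G.code {⟨k, hk⟩} := by simp [h₂, Instr.run, h16, hpow]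
    have e27 : s₂.reg 27 = G.code {⟨k, hk⟩} + (G.lifetime * (n * n) + (⟨k, hk⟩ : Fin n) * n) := by
      simp [h₂, Instr.run, h16, hpow, hF.reg 13 rfl, e13, h15, Nat.add_assoc]
    have hL₂ : G.Represents L s₂ := hL.congr (hF₂.reg 30 rfl) (hF₂.arr 2 rfl) (hF₂.arr 3 rfl)
      (hF₂.arr 4 rfl) (hF₂.arr 6 rfl) fun S hS => hS.update _ a5
    have hst : G.Stored {⟨k, hk⟩} s₂ := by
      intro u
      rw [a5]
      by_cases hu : u = ⟨k, hk⟩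
      · rw [hu, Function.update_self]
      · rw [Function.update_of_ne (fun h => hu (Fin.ext (Nat.add_left_cancel h))),
          hzero ⟨k, hk⟩ u le_rfl, ind_false (by simpa using hu)]
    have hnew : (G.lifetime, (⟨k, hk⟩ : Fin n), ({⟨k, hk⟩} : Finset (Fin n))) ∉ L :=
      fun h => absurd (hlt _ h) (lt_irrefl k)
    refine .seq (pushProg_runs hs₂ hL₂ hst hnew (.last _) ?_ ?_ e19 e27)
      fun s₃ hF₃ h₃ => .block _ fun s₄ h₄ hF₄ => ⟨?_, ?_, _, h₃.frame hF₄ (by decide), ?_, ?_⟩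
    · rw [hF₂.reg 13 rfl, hF.reg 13 rfl, e13]
    · rw [hF₂.reg 15 rfl, h15]
    · simp [h₄, Instr.run, hF₃.reg 15 rfl, hF₂.reg 15 rfl, h15, hF₃.reg 2 rfl, hs₂.vertices,
        Nat.succ_mul]
    · intro v u hv
      rw [hF₄.arr 5 rfl, hF₃.arr 5 rfl, a5, Function.update_of_ne, hzero v u (by omega)]
      intro heq
      have h1 := (code_inj (vert_lt u) (vert_lt _) heq).1
      have h2 : v = ⟨k, hk⟩ := Finset.singleton_injective h1
      rw [h2] at hv
      exact absurd hv (Nat.not_succ_le_self k)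
    · intro v hv
      rcases Nat.lt_succ_iff_lt_or_eq.1 hv with hv | hv
      · exact List.mem_append_left _ (hall v hv)
      · obtain rfl : v = ⟨k, hk⟩ := Fin.ext hv
        simp
    · intro x hx
      rcases List.mem_append.1 hx with hx | hx
      · exact (hlt x hx).trans (Nat.lt_succ_self k)
      · rw [List.mem_singleton.1 hx]
        exact Nat.lt_succ_self k

end TemporalGraph

namespace TemporalGraph

variable {n : ℕ} {G : TemporalGraph (Fin n)}

/-- The indicator function of the set with code in register `12`, extended by the vertex in
register `16`, is written behind the code in register `19`.  The flag in register `20` is cleared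
if a vertex outside the extended set lies outside the row of the reachability table at the address
in register `21`. -/
def copyProg : Prog :=
  forLoop 22 2
    (.seq (block [.add 24 12 22, .load 23 5 24])
      (.seq (.branch (.eq 22 16) (block [.const 23 1]) (block []))
        (.seq (block [.add 24 19 22, .store 5 24 23, .add 24 21 22, .load 25 1 24, .add 26 23 25])
          (.branch (.eq 26 7) (block [.const 20 0]) (block [])))))

theorem copyProg_runs {s : Store} (h : G.Tables s) {t : ℕ} (ht : t ≤ G.lifetime) {w : Fin n}
    {S : Finset (Fin n)} {p : Prop} (hS : G.Stored S s) (h12 : s.reg 12 = G.code S)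
    (h16 : s.reg 16 = w) (h19 : s.reg 19 = G.code (insert w S)) (h20 : s.reg 20 = ind p)
    (h21 : s.reg 21 = t * (n * n) + w * n) :
    Runs copyProg (n * (3 + (2 + 1 + (6 + (2 + 1))) + 2) + 2)
      (fun s' => G.Stored (insert w S) s' ∧ (∀ T, G.Stored T s → G.Stored T s') ∧
        s'.reg 20 = ind (p ∧ ∀ u ∉ insert w S, G.ReachBy t w u)) s := by
  refine (Runs.forLoop (fun k s' => (∀ T, G.Stored T s → G.Stored T s') ∧
    (∀ u : Fin n, u < k → s'.arr 5 (G.code (insert w S) + u) = ind (u ∈ insert w S)) ∧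
    s'.reg 20 = ind (p ∧ ∀ u : Fin n, u < k → u ∉ insert w S → G.ReachBy t w u))
    n (3 + (2 + 1 + (6 + (2 + 1)))) h.vertices h.one ?_ ?_ ?_).mono le_rfl fun s' _ ⟨h1, h2, h3⟩ =>
      ⟨fun u => h2 u u.2, h1, h3.trans (ind_congr (and_congr_right fun _ => ?_))⟩
  · rintro k s₁ s₂ ⟨h1, h2, h3⟩ hr ha
    simp only [Stored, ha, hr 20 (by decide)]
    exact ⟨h1, h2, h3⟩
  · refine ⟨fun _ h => h, fun u hu => absurd hu (Nat.not_lt_zero _), ?_⟩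
    rw [h20]
    exact ind_congr (iff_self_and.2 fun _ u hu => absurd hu (Nat.not_lt_zero _))
  · rintro k s₁ hk hF₁ ⟨h1, h2, h3⟩ h22
    have hs₁ := h.frame hF₁ (by decide)
    have hSk := h1 S hS ⟨k, hk⟩
    simp only at hSk
    refine .block_seq _ fun s₂ h₂ hF₂ => ?_
    have e23 : s₂.reg 23 = ind ((⟨k, hk⟩ : Fin n) ∈ S) := by
      rw [← hSk]
      simp [h₂, Instr.run, hF₁.reg 12 rfl, h12, h22]
    have e22 : s₂.reg 22 = k := by rw [hF₂.reg 22 rfl, h22]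
    have e16 : s₂.reg 16 = w := by rw [hF₂.reg 16 rfl, hF₁.reg 16 rfl, h16]
    refine .seq (P := fun s' => s'.reg 23 = ind ((⟨k, hk⟩ : Fin n) ∈ insert w S))
      (.branch (T := 2) (fun hb => .block _ fun s' h' _ => ?_)
        fun hb => .block_le _ (by decide) fun s' h' _ => ?_)
      fun s₃ hF₃ h₃ => ?_
    · simp only [Test.Holds, e22, e16] at hb
      rw [ind_true (Finset.mem_insert.2 (Or.inl (Fin.ext hb)))]
      simp [h', Instr.run]
    · simp only [Test.Holds, e22, e16] at hb
      rw [h']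
      refine e23.trans (ind_congr ?_)
      rw [Finset.mem_insert]
      exact ⟨Or.inr, fun h => h.resolve_left fun h => hb (congrArg Fin.val h)⟩
    have hs₃ := (hs₁.frame hF₂ (by decide)).frame hF₃ (by decide)
    have r19 : s₃.reg 19 = G.code (insert w S) := by
      rw [hF₃.reg 19 rfl, hF₂.reg 19 rfl, hF₁.reg 19 rfl, h19]
    have r21 : s₃.reg 21 = t * (n * n) + w * n := by
      rw [hF₃.reg 21 rfl, hF₂.reg 21 rfl, hF₁.reg 21 rfl, h21]
    have r22 : s₃.reg 22 = k := by rw [hF₃.reg 22 rfl, e22]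
    have a5₃ : s₃.arr 5 = s₁.arr 5 := by rw [hF₃.arr 5 rfl, hF₂.arr 5 rfl]
    refine .block_seq _ fun s₄ h₄ hF₄ => ?_
    have hs₄ := hs₃.frame hF₄ (by decide)
    have a5₄ : s₄.arr 5 = Function.update (s₃.arr 5)
        (G.code (insert w S) + (⟨k, hk⟩ : Fin n)) (ind ((⟨k, hk⟩ : Fin n) ∈ insert w S)) := by
      rw [← h₃]
      simp [h₄, Instr.run, r19, r22]
    have hreach := hs₃.reach t ht w ⟨k, hk⟩
    simp only at hreach
    have e26 : s₄.reg 26 = ind ((⟨k, hk⟩ : Fin n) ∈ insert w S) +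
        ind (G.ReachBy t w ⟨k, hk⟩) := by
      rw [← h₃, ← hreach]
      simp [h₄, Instr.run, r21, r22]
    have e20 : s₄.reg 20 = ind (p ∧ ∀ u : Fin n, u < k → u ∉ insert w S → G.ReachBy t w u) := by
      rw [hF₄.reg 20 rfl, hF₃.reg 20 rfl, hF₂.reg 20 rfl, h3]
    have hsucc : (p ∧ ∀ u : Fin n, u < k + 1 → u ∉ insert w S → G.ReachBy t w u) ↔
        (p ∧ ∀ u : Fin n, u < k → u ∉ insert w S → G.ReachBy t w u) ∧
          ((⟨k, hk⟩ : Fin n) ∈ insert w S ∨ G.ReachBy t w ⟨k, hk⟩) := by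
      rw [and_assoc]
      refine and_congr_right fun _ => ⟨fun h => ⟨fun u hu => h u (by omega), ?_⟩, fun h u hu => ?_⟩
      · exact or_iff_not_imp_left.2 (h ⟨k, hk⟩ (Nat.lt_succ_self k))
      · rcases Nat.lt_succ_iff_lt_or_eq.1 hu with hu | hu
        · exact h.1 u hu
        · obtain rfl : u = ⟨k, hk⟩ := Fin.ext hu
          exact or_iff_not_imp_left.1 h.2
    refine Runs.mono (.branch (T := 2)
      (Q := fun s' => s'.arr 5 = s₄.arr 5 ∧ s'.reg 20 =
        ind (p ∧ ∀ u : Fin n, u < k + 1 → u ∉ insert w S → G.ReachBy t w u))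
      (fun hb => .block _ fun s' h' hF' => ⟨hF'.arr 5 rfl, ?_⟩)
      fun hb => .block_le _ (by decide) fun s' h' hF' => ⟨hF'.arr 5 rfl, ?_⟩) le_rfl
        fun s₅ hF₅ ⟨a5₅, e20'⟩ => ⟨fun T hT => ?_, fun u hu => ?_, e20'⟩
    · simp only [Test.Holds, e26, hs₄.zero, Nat.add_eq_zero_iff, ind_eq_zero] at hb
      rw [ind_false (fun h => (hsucc.1 h).2.elim hb.1 hb.2)]
      simp [h', Instr.run]
    · simp only [Test.Holds, e26, hs₄.zero, Nat.add_eq_zero_iff, ind_eq_zero] at hb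
      rw [hF'.reg 20 rfl, e20]
      exact ind_congr ⟨fun h => hsucc.2 ⟨h, by tauto⟩, fun h => (hsucc.1 h).1⟩
    · have hT₃ : G.Stored T s₃ := by
        rw [Stored, a5₃]
        exact h1 T hT
      rw [Stored, a5₅]
      exact hT₃.update _ a5₄
    · rw [a5₅, a5₄]
      by_cases huk : u = ⟨k, hk⟩
      · rw [huk, Function.update_self]
      · have : (u : ℕ) ≠ k := fun h => huk (Fin.ext h)
        rw [Function.update_of_ne (fun h => huk (Fin.ext (Nat.add_left_cancel h))), a5₃,
          h2 u (by omega)]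
  · exact ⟨fun h u => h u u.2, fun h u _ => h u⟩

/-- The state `(t, w, insert w S)` is a successor of the state `(t + 1, v, S)`. -/
def Step (G : TemporalGraph (Fin n)) (t : ℕ) (v w : Fin n) (S : Finset (Fin n)) : Prop :=
  (w = v ∨ G.TimeEdge s(v, w) (t + 1) ∧ w ∉ S) ∧ ∀ u ∉ insert w S, G.ReachBy t w u

/-- For the state `(t + 1, v, S)` described by the registers `11`, `12` and `13`, the candidate
`(t, w, insert w S)` is appended to the list if it is a new state.  Register `14` holds the address
of the pair `(v, w)` in the input, `15` holds `w n`, and `16` holds `w`.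

The code of `insert w S` is computed correctly even if `w ∈ S`, so that the entries written by
`copyProg` are correct whether or not the candidate is accepted. -/
def candidateProg : Prog :=
  .seq (block [.add 24 12 16, .load 17 5 24, .load 18 0 14])
    (.seq (.branch (.eq 17 1) (block [.copy 19 12]) (block [.load 19 8 16, .add 19 12 19]))
      (.seq (.branch (.eq 15 11) (block [.const 20 1])
          (.branch (.eq 17 7) (block [.copy 20 18]) (block [.const 20 0])))
        (.seq (block [.add 21 13 15])
          (.seq copyProg
            (.seq (block [.add 27 19 21, .load 28 6 27])
              (.seq (.branch (.lt 28 20) pushProg (block []))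
                (block [.add 15 15 2, .add 14 14 1])))))))

theorem candidateProg_runs {s : Store} {L : List (ℕ × Fin n × Finset (Fin n))} (h : G.Tables s)
    (hL : G.Represents L s) {t : ℕ} (ht : t < G.lifetime) {v w : Fin n} {S : Finset (Fin n)}
    (hmem : (t + 1, v, S) ∈ L) (h11 : s.reg 11 = v * n) (h12 : s.reg 12 = G.code S)
    (h13 : s.reg 13 = t * (n * n)) (h14 : s.reg 14 = 2 + (t * (n * n) + v * n + w))
    (h15 : s.reg 15 = w * n) (h16 : s.reg 16 = w) :
    Runs candidateProg (4 + (3 + 1 + (2 + 1 + 1 + (2 + (n * 17 + 2 + (3 + (6 + 1 + 3)))))))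
      (fun s' => s'.reg 15 = (w + 1) * n ∧ s'.reg 14 = 2 + (t * (n * n) + v * n + (w + 1)) ∧
        ∃ L', L <+: L' ∧ G.Represents L' s' ∧ (G.Step t v w S → (t, w, insert w S) ∈ L')) s := by
  have hSs : G.Stored S s := hL.stored _ hmem
  refine .block_seq _ fun s₁ h₁ hF₁ => ?_
  have hs₁ := h.frame hF₁ (by decide)
  have e17 : s₁.reg 17 = ind (w ∈ S) := by
    rw [← hSs w]
    simp [h₁, Instr.run, h12, h16]
  have e18 : s₁.reg 18 = ind (G.TimeEdge s(v, w) (t + 1)) := by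
    rw [← h.input t ht v w]
    simp [h₁, Instr.run, h14]
  have hpow := hs₁.powers w
  have e16 : s₁.reg 16 = w := by rw [hF₁.reg 16 rfl, h16]
  have e12 : s₁.reg 12 = G.code S := by rw [hF₁.reg 12 rfl, h12]
  refine .seq (P := fun s' => s'.reg 19 = G.code (insert w S)) (.branch (T := 3)
    (fun hb => .block_le _ (by decide) fun s' h' _ => ?_)
    fun hb => .block _ fun s' h' _ => ?_) fun s₂ hF₂ h₂ => ?_
  · simp only [Test.Holds, e17, hs₁.one, ind_eq_one] at hb
    rw [Finset.insert_eq_of_mem hb]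
    simp [h', Instr.run, e12]
  · simp only [Test.Holds, e17, hs₁.one, ind_eq_one] at hb
    rw [code_insert hb, ← hpow]
    simp [h', Instr.run, e12, e16]
  have hs₂ := hs₁.frame hF₂ (by decide)
  have f17 : s₂.reg 17 = ind (w ∈ S) := by rw [hF₂.reg 17 rfl, e17]
  have f18 : s₂.reg 18 = ind (G.TimeEdge s(v, w) (t + 1)) := by rw [hF₂.reg 18 rfl, e18]
  have f15 : s₂.reg 15 = w * n := by rw [hF₂.reg 15 rfl, hF₁.reg 15 rfl, h15]
  have f11 : s₂.reg 11 = v * n := by rw [hF₂.reg 11 rfl, hF₁.reg 11 rfl, h11]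
  refine .seq (P := fun s' => s'.reg 20 = ind (w = v ∨ G.TimeEdge s(v, w) (t + 1) ∧ w ∉ S))
    (.branch (T := 2 + 1)
      (fun hb => .block_le _ (by decide) fun s' h' _ => ?_)
      fun hb => .branch (T := 2) (fun hb' => .block _ fun s' h' _ => ?_)
        fun hb' => .block _ fun s' h' _ => ?_) fun s₃ hF₃ h₃ => ?_
  · simp only [Test.Holds, f15, f11] at hb
    have hwv : w = v := Fin.ext (Nat.eq_of_mul_eq_mul_right v.pos hb)
    rw [ind_true (Or.inl hwv)]
    simp [h', Instr.run]
  · simp only [Test.Holds, f15, f11] at hb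
    simp only [Test.Holds, f17, hs₂.zero, ind_eq_zero] at hb'
    have hwv : w ≠ v := fun h => hb (by rw [h])
    have : s'.reg 20 = s₂.reg 18 := by simp [h', Instr.run]
    rw [this, f18]
    exact ind_congr ⟨fun h => Or.inr ⟨h, hb'⟩, fun h => (h.resolve_left hwv).1⟩
  · simp only [Test.Holds, f15, f11] at hb
    simp only [Test.Holds, f17, hs₂.zero, ind_eq_zero, not_not] at hb'
    have hwv : w ≠ v := fun h => hb (by rw [h])
    rw [ind_false (fun h => (h.resolve_left hwv).2 hb')]
    simp [h', Instr.run]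
  have hs₃ := hs₂.frame hF₃ (by decide)
  refine .block_seq _ fun s₄ h₄ hF₄ => ?_
  have hs₄ := hs₃.frame hF₄ (by decide)
  have g13 : s₄.reg 13 = t * (n * n) := by
    rw [hF₄.reg 13 rfl, hF₃.reg 13 rfl, hF₂.reg 13 rfl, hF₁.reg 13 rfl, h13]
  have g15 : s₄.reg 15 = w * n := by rw [hF₄.reg 15 rfl, hF₃.reg 15 rfl, f15]
  have g21 : s₄.reg 21 = t * (n * n) + w * n := by
    rw [← g13, ← g15, hF₄.reg 13 rfl, hF₄.reg 15 rfl]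
    simp [h₄, Instr.run]
  have g19 : s₄.reg 19 = G.code (insert w S) := by rw [hF₄.reg 19 rfl, hF₃.reg 19 rfl, h₂]
  have hL₄ := (((hL.frame hF₁ (by decide)).frame hF₂ (by decide)).frame hF₃ (by decide)).frame
    hF₄ (by decide)
  refine .seq (copyProg_runs (S := S) hs₄ ht.le (hL₄.stored _ hmem) ?_ ?_ g19
    (p := w = v ∨ G.TimeEdge s(v, w) (t + 1) ∧ w ∉ S) ?_ g21)
    fun s₅ hF₅ ⟨hst, hkeep, h20⟩ => ?_
  · rw [hF₄.reg 12 rfl, hF₃.reg 12 rfl, hF₂.reg 12 rfl, e12]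
  · rw [hF₄.reg 16 rfl, hF₃.reg 16 rfl, hF₂.reg 16 rfl, e16]
  · rw [hF₄.reg 20 rfl, h₃]
  have hs₅ := hs₄.frame hF₅ (by decide)
  have hL₅ : G.Represents L s₅ := hL₄.congr (hF₅.reg 30 rfl) (hF₅.arr 2 rfl) (hF₅.arr 3 rfl)
    (hF₅.arr 4 rfl) (hF₅.arr 6 rfl) hkeep
  refine .block_seq _ fun s₆ h₆ hF₆ => ?_
  have hs₆ := hs₅.frame hF₆ (by decide)
  have hL₆ := hL₅.frame hF₆ (by decide)
  have k27 : s₆.reg 27 = G.code (insert w S) + (t * (n * n) + w * n) := by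
    rw [← g19, ← g21, ← hF₅.reg 19 rfl, ← hF₅.reg 21 rfl]
    simp [h₆, Instr.run]
  have k28 : s₆.reg 28 = ind ((t, w, insert w S) ∈ L) := by
    rw [← hL₆.found t ht.le, ← k27]
    simp [h₆, Instr.run]
  have k20 : s₆.reg 20 = ind (G.Step t v w S) := by rw [hF₆.reg 20 rfl, h20, Step]
  have hst₆ : G.Stored (insert w S) s₆ := by
    rw [Stored, hF₆.arr 5 rfl]
    exact hst
  have k15 : s₆.reg 15 = w * n := by rw [hF₆.reg 15 rfl, hF₅.reg 15 rfl, g15]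
  refine .seq (P := fun s' => ∃ L', L <+: L' ∧ G.Represents L' s' ∧
      (G.Step t v w S → (t, w, insert w S) ∈ L')) (.branch (T := 6)
    (fun hb => (pushProg_runs hs₆ hL₆ hst₆ ?_ ?_ ?_ k15 ?_ k27).mono le_rfl fun s' _ h' =>
      ⟨_, List.prefix_append _ _, h', fun _ => by simp⟩)
    fun hb => .block_le _ (by decide) fun s' h' hF' =>
      ⟨L, List.prefix_rfl, hL₆.frame hF' (by decide), fun hstep => ?_⟩)
    fun s₇ hF₇ ⟨L', hp, hL', hin⟩ => .block _ fun s₈ h₈ hF₈ =>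
      ⟨?_, ?_, L', hp, hL'.frame hF₈ (by decide), hin⟩
  · simp only [Test.Holds, k28, k20] at hb
    have := ind_le_one (G.Step t v w S)
    exact ind_eq_zero.1 (by omega)
  · simp only [Test.Holds, k28, k20] at hb
    have := ind_le_one (G.Step t v w S)
    obtain ⟨h1, h2⟩ : G.Step t v w S := ind_eq_one.1 (by omega)
    exact .prev (hL.sound _ hmem) h1 h2
  · rw [hF₆.reg 13 rfl, hF₅.reg 13 rfl, g13]
  · rw [hF₆.reg 19 rfl, hF₅.reg 19 rfl, g19]
  · simp only [Test.Holds, k28, k20, ind_true hstep] at hb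
    by_contra hnot
    exact hb (by rw [ind_false hnot]; exact one_pos)
  · have e2 : s₇.reg 2 = n := by rw [hF₇.reg 2 rfl, hs₆.vertices]
    have e15 : s₇.reg 15 = w * n := by rw [hF₇.reg 15 rfl, k15]
    simp [h₈, Instr.run, e2, e15, Nat.succ_mul]
  · have e1 : s₇.reg 1 = 1 := by rw [hF₇.reg 1 rfl, hs₆.one]
    have e14 : s₇.reg 14 = 2 + (t * (n * n) + v * n + w) := by
      rw [hF₇.reg 14 rfl, hF₆.reg 14 rfl, hF₅.reg 14 rfl, hF₄.reg 14 rfl, hF₃.reg 14 rfl,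
        hF₂.reg 14 rfl, hF₁.reg 14 rfl, h14]
    simp [h₈, Instr.run, e1, e14, Nat.add_assoc]

/-- The program that expands one state.  The entry of the list with the index in register `9` is
read.  If its time is `0`, the answer in register `0` is set, and otherwise all successors are
appended. -/
def expandProg : Prog :=
  .seq (block [.load 10 2 9, .load 11 3 9, .load 12 4 9])
    (.seq (.branch (.lt 10 4) (block [.const 0 1])
        (.seq (block [.sub 13 10 4, .add 14 13 11, .add 14 14 8, .const 15 0])
          (forLoop 16 2 candidateProg)))
      (block [.add 9 9 1]))

/-- All successors of the state `x` are in the list `L`. -/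
def Expanded (G : TemporalGraph (Fin n)) (L : List (ℕ × Fin n × Finset (Fin n)))
    (x : ℕ × Fin n × Finset (Fin n)) : Prop :=
  ∀ t, x.1 = t + 1 → ∀ w, G.Step t x.2.1 w x.2.2 → (t, w, insert w x.2.2) ∈ L

theorem expandProg_runs {s : Store} {L : List (ℕ × Fin n × Finset (Fin n))} (h : G.Tables s)
    (hL : G.Represents L s) {i : ℕ} (hi : i < L.length) (h9 : s.reg 9 = i) {p : Prop}
    (h0 : s.reg 0 = ind p) :
    Runs expandProg (4 + (5 + (n * (n * 17 + 29 + 2) + 2) + 1 + 2))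
      (fun s' => s'.reg 9 = i + 1 ∧ s'.reg 0 = ind (p ∨ L[i].1 = 0) ∧
        ∃ L', L <+: L' ∧ G.Represents L' s' ∧ G.Expanded L' L[i]) s := by
  obtain ⟨⟨r, v, S⟩, hx⟩ : ∃ x, L[i] = x := ⟨_, rfl⟩
  rw [hx]
  have hmem : (r, v, S) ∈ L := hx ▸ List.getElem_mem hi
  have ha2 := hL.time i hi
  have ha3 := hL.vertex i hi
  have ha4 := hL.set i hi
  simp only [hx] at ha2 ha3 ha4
  refine .block_seq _ fun s₁ h₁ hF₁ => ?_
  have hs₁ := h.frame hF₁ (by decide)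
  have hL₁ := hL.frame hF₁ (by decide)
  have e10 : s₁.reg 10 = r * (n * n) := by simp [h₁, Instr.run, h9, ha2]
  have e11 : s₁.reg 11 = v * n := by simp [h₁, Instr.run, h9, ha3]
  have e12 : s₁.reg 12 = G.code S := by simp [h₁, Instr.run, h9, ha4]
  have e0 : s₁.reg 0 = ind p := by rw [hF₁.reg 0 rfl, h0]
  have e9 : s₁.reg 9 = i := by rw [hF₁.reg 9 rfl, h9]
  have hnn : 0 < n * n := Nat.mul_pos v.pos v.pos
  refine .seq (P := fun s' => s'.reg 9 = i ∧ s'.reg 1 = 1 ∧ s'.reg 0 = ind (p ∨ r = 0) ∧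
      ∃ L', L <+: L' ∧ G.Represents L' s' ∧ G.Expanded L' (r, v, S))
    (.branch (T := 5 + (n * (n * 17 + 29 + 2) + 2))
    (fun hb => .block_le _ (Nat.le_add_right_of_le (by decide)) fun s' h' hF' =>
      ⟨?_, ?_, ?_, L, List.prefix_rfl,
      hL₁.frame hF' (by decide), ?_⟩)
    fun hb => ?_) fun s₂ hF₂ ⟨f9, f1, f0, L', hp, hL', hex⟩ => .block _ fun s₃ h₃ hF₃ =>
      ⟨?_, ?_, L', hp, hL'.frame hF₃ (by decide), hex⟩
  · rw [hF'.reg 9 rfl, e9]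
  · rw [hF'.reg 1 rfl, hs₁.one]
  -- the position `r n²` is less than `n²` exactly at time `r = 0`
  · simp only [Test.Holds, e10, hs₁.square] at hb
    have hr : r = 0 := by
      by_contra hr
      have : 1 * (n * n) ≤ r * (n * n) := Nat.mul_le_mul_right _ (Nat.pos_of_ne_zero hr)
      omega
    rw [ind_true (Or.inr hr)]
    simp [h', Instr.run]
  · simp only [Test.Holds, e10, hs₁.square] at hb
    intro t ht
    have : 1 * (n * n) ≤ r * (n * n) := Nat.mul_le_mul_right _ (by simp only at ht; omega)
    omega
  · simp only [Test.Holds, e10, hs₁.square] at hb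
    obtain ⟨t, rfl⟩ : ∃ t, r = t + 1 := by
      refine Nat.exists_eq_succ_of_ne_zero fun hr => hb ?_
      rw [hr, Nat.zero_mul]
      exact hnn
    have ht : t < G.lifetime := (hL.sound _ hmem).le_lifetime
    refine .block_seq _ fun s₂ h₂ hF₂ => ?_
    have hs₂ := hs₁.frame hF₂ (by decide)
    have e13 : s₂.reg 13 = t * (n * n) := by
      simp [h₂, Instr.run, e10, hs₁.square, Nat.succ_mul]
    have e14 : s₂.reg 14 = 2 + (t * (n * n) + v * n) := by
      simp [h₂, Instr.run, e10, e11, hs₁.square, hs₁.two, Nat.succ_mul, Nat.add_comm]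
    refine Runs.mono (.forLoop (fun k s' => s'.reg 15 = k * n ∧
      s'.reg 14 = 2 + (t * (n * n) + v * n + k) ∧ ∃ L', L <+: L' ∧ G.Represents L' s' ∧
        ∀ w : Fin n, (w : ℕ) < k → G.Step t v w S → (t, w, insert w S) ∈ L') n (n * 17 + 29)
        hs₂.vertices hs₂.one ?_ ?_ ?_) le_rfl ?_
    · rintro k s s' ⟨h1, h2, L', h3, h4, h5⟩ hr ha
      refine ⟨by rw [hr 15 (by decide), h1], by rw [hr 14 (by decide), h2], L', h3, ?_, h5⟩
      refine h4.congr (hr 30 (by decide)) (by rw [ha]) (by rw [ha]) (by rw [ha]) (by rw [ha])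
        fun S hS => ?_
      rw [Stored, ha]
      exact hS
    · exact ⟨by simp [h₂, Instr.run], e14, L, List.prefix_rfl, hL₁.frame hF₂ (by decide),
        fun w hw => absurd hw (Nat.not_lt_zero _)⟩
    · rintro k s₃ hk hF₃ ⟨h15, h14, L', hp, hL', hin⟩ h16
      refine (candidateProg_runs (hs₂.frame hF₃ (by decide)) hL' ht (w := ⟨k, hk⟩)
        (hp.subset hmem) ?_ ?_ ?_ h14 h15 h16).mono (by omega) ?_
      · rw [hF₃.reg 11 rfl, hF₂.reg 11 rfl, e11]
      · rw [hF₃.reg 12 rfl, hF₂.reg 12 rfl, e12]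
      · rw [hF₃.reg 13 rfl, e13]
      · rintro s₄ - ⟨g15, g14, L'', hp', hL'', hin'⟩
        refine ⟨g15, g14, L'', hp.trans hp', hL'', fun w hw hstep => ?_⟩
        rcases Nat.lt_succ_iff_lt_or_eq.1 hw with hw | hw
        · exact hp'.subset (hin w hw hstep)
        · obtain rfl : w = ⟨k, hk⟩ := Fin.ext hw
          exact hin' hstep
    · rintro s₃ hF₃ ⟨-, -, L', hp, hL', hin⟩
      refine ⟨?_, ?_, ?_, L', hp, hL', ?_⟩
      · rw [hF₃.reg 9 rfl, hF₂.reg 9 rfl, e9]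
      · rw [hF₃.reg 1 rfl, hs₂.one]
      · rw [hF₃.reg 0 rfl, hF₂.reg 0 rfl, e0]
        exact ind_congr ⟨Or.inl, fun h => h.resolve_right (Nat.succ_ne_zero t)⟩
      · intro t' ht' w hstep
        obtain rfl : t = t' := Nat.succ.inj ht'
        exact hin w w.2 hstep
  · simp [h₃, Instr.run, f9, f1]
  · rw [hF₃.reg 0 rfl, f0]

/-- The list is searched from its beginning while it grows. -/
def searchProg : Prog := .loop (.lt 9 30) expandProg

/-- The list has no repetitions, so the number of rounds is at most the number of states; and when
the scan is complete, the list is closed under successors and hence contains all states. -/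
theorem searchProg_runs (hG : G.HasTimeEdge) {s : Store}
    {L : List (ℕ × Fin n × Finset (Fin n))} (h : G.Tables s) (hL : G.Represents L s)
    (hinit : ∀ v, (G.lifetime, v, {v}) ∈ L) (h0 : s.reg 0 = 0) (h9 : s.reg 9 = 0) :
    Runs searchProg ((G.lifetime + 1) * n ^ 2 * 2 ^ G.timWidth *
        (4 + (5 + (n * (n * 17 + 29 + 2) + 2) + 1 + 2) + 1) + 1)
      (fun s' => s'.reg 0 = ind G.HasHamiltonianPath) s := by
  refine (Runs.loop (fun k s' => s'.reg 9 = k ∧ ∃ L', L <+: L' ∧ G.Represents L' s' ∧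
    k ≤ L'.length ∧ s'.reg 0 = ind (∃ x ∈ L'.take k, x.1 = 0) ∧
    ∀ x ∈ L'.take k, G.Expanded L' x) _ _ ?_ ?_).mono le_rfl ?_
  · refine ⟨h9, L, List.prefix_rfl, hL, Nat.zero_le _, ?_, ?_⟩
    · rw [h0, ind_false]
      simp
    · simp
  · rintro k s₁ hF₁ ⟨e9, L', hp, hL', -, e0, hex⟩ hb
    simp only [Test.Holds, e9, hL'.length] at hb
    refine ⟨lt_of_lt_of_le hb ?_, ?_⟩
    · have := SuffixState.card_le hG L'.toFinset fun x hx => hL'.sound x (List.mem_toFinset.1 hx)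
      rwa [List.toFinset_card_of_nodup hL'.nodup, Fintype.card_fin] at this
    · refine (expandProg_runs (h.frame hF₁ (by decide)) hL' hb e9 e0).mono le_rfl ?_
      rintro s₂ - ⟨f9, f0, L'', hp', hL'', hex'⟩
      have hle : k < L''.length := hb.trans_le hp'.length_le
      have htake : L''.take (k + 1) = L'.take k ++ [L'[k]] := by
        obtain ⟨l, rfl⟩ := hp'
        rw [List.take_append_of_le_length hb, List.take_concat_get' _ _ hb]
      refine ⟨f9, L'', hp.trans hp', hL'', hle, ?_, ?_⟩
      · rw [f0, htake]
        simp only [List.mem_append, List.mem_singleton, or_and_right, exists_or, exists_eq_left]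
      · intro x hx
        rw [htake, List.mem_append, List.mem_singleton] at hx
        rcases hx with hx | rfl
        · exact fun t ht w hstep => hp'.subset (hex x hx t ht w hstep)
        · exact hex'
  · rintro s₁ - ⟨k, ⟨e9, L', hp, hL', hk, e0, hex⟩, hb⟩
    simp only [Test.Holds, e9, hL'.length] at hb
    rw [List.take_of_length_le (not_lt.1 hb)] at e0 hex
    rw [e0, hasHamiltonianPath_iff hG]
    refine ind_congr ⟨?_, ?_⟩
    · rintro ⟨⟨t, v, S⟩, hx, rfl⟩
      exact ⟨v, S, hL'.sound _ hx⟩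
    · rintro ⟨v, S, hvS⟩
      have hall : ∀ {t v S}, G.SuffixState t v S → (t, v, S) ∈ L' := by
        intro t v S h
        induction h with
        | last v => exact hp.subset (hinit v)
        | prev _ h1 h2 ih => exact hex _ ih _ rfl _ ⟨h1, h2⟩
      exact ⟨_, hall hvS, rfl⟩

end TemporalGraph

/-! ### The running time -/

namespace TemporalGraph

/-- The program that decides Temporal Hamiltonian Path. -/
def hamiltonianProg : Prog :=
  .seq sizesProg (.seq powersProg (.seq diagProg (.seq reachProg (.seq initProg searchProg))))

theorem hamiltonianProg_runs {n : ℕ} {G : TemporalGraph (Fin n)} (hG : G.HasTimeEdge) :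
    Runs hamiltonianProg
      (5 + (n * (2 + 2) + 2 + (G.lifetime * (2 + 2) + 2 + 2)) + (2 + (n * (3 + 2) + 2) +
        (2 + (n * (4 + 2) + 2) +
        (2 + (G.lifetime *
          (2 + (n * (2 + (n * (5 + (n * 12 + 2 + 3) + 2) + 2 + 2) + 2) + 2 + 2) + 2) + 2) +
        (3 + (n * (6 + (6 + 2) + 2) + 2) +
        ((G.lifetime + 1) * n ^ 2 * 2 ^ G.timWidth *
          (4 + (5 + (n * (n * 17 + 29 + 2) + 2) + 1 + 2) + 1) + 1))))))
      (fun s => s.reg 0 = ind G.HasHamiltonianPath) (init G.encode) := by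
  refine .seq sizesProg_runs fun s₁ hF₁ ⟨h₁, h0, h30, harr⟩ => ?_
  refine .seq (powersProg_runs h₁) fun s₂ hF₂ hpow => ?_
  have h₂ := h₁.frame hF₂ (by decide)
  refine .seq (diagProg_runs h₂ fun a => ?_) fun s₃ hF₃ hdiag => ?_
  · rw [hF₂.arr 1 rfl, harr 1 one_pos]
  have h₃ := h₂.frame hF₃ (by decide)
  refine .seq (reachProg_runs h₃ hdiag) fun s₄ hF₄ hfill => ?_
  have htab : G.Tables s₄ := by
    refine ⟨h₃.frame hF₄ (by decide), fun u => ?_, fun t ht v u => hfill t ht v u ?_⟩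
    · rw [hF₄.arr 8 rfl, hF₃.arr 8 rfl, hpow u u.2]
    · have h1 : t * (n * n) ≤ G.lifetime * (n * n) := Nat.mul_le_mul_right _ ht
      have h2 := row_add_lt v u
      omega
  refine .seq (initProg_runs htab ?_ (fun a => ?_) fun a => ?_) fun s₅ hF₅ ⟨L, hL, hinit⟩ =>
    searchProg_runs hG (htab.frame hF₅ (by decide)) hL hinit ?_ ?_
  · rw [hF₄.reg 30 rfl, hF₃.reg 30 rfl, hF₂.reg 30 rfl, h30]
  · rw [hF₄.arr 5 rfl, hF₃.arr 5 rfl, hF₂.arr 5 rfl, harr 5 (by decide)]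
  · rw [hF₄.arr 6 rfl, hF₃.arr 6 rfl, hF₂.arr 6 rfl, harr 6 (by decide)]
  · rw [hF₅.reg 0 rfl, hF₄.reg 0 rfl, hF₃.reg 0 rfl, hF₂.reg 0 rfl, h0]
  · rw [hF₅.reg 9 rfl, hF₄.reg 9 rfl, hF₃.reg 9 rfl, hF₂.reg 9 rfl, hF₁.reg 9 rfl]
    rfl

/-- An estimate of the running time for `n` vertices and lifetime `l`, where `p` bounds the number
of states for each choice of a time and of the first and the last vertex of a path. -/
theorem time_le {n l x p : ℕ} (hn : n ≤ x) (hl : l ≤ x) (hx : 2 ≤ x) (hp : 1 ≤ p) :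
    5 + (n * (2 + 2) + 2 + (l * (2 + 2) + 2 + 2)) + (2 + (n * (3 + 2) + 2) +
        (2 + (n * (4 + 2) + 2) +
        (2 + (l * (2 + (n * (2 + (n * (5 + (n * 12 + 2 + 3) + 2) + 2 + 2) + 2) + 2 + 2) + 2) + 2) +
        (3 + (n * (6 + (6 + 2) + 2) + 2) +
        ((l + 1) * n ^ 2 * p * (4 + (5 + (n * (n * 17 + 29 + 2) + 2) + 1 + 2) + 1) + 1))))) ≤
      x ^ 13 * p := by
  have h0 : 1 ≤ x ^ 5 := Nat.one_le_pow _ _ (by omega)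
  have hpow : ∀ i ≤ 5, x ^ i ≤ x ^ 5 := fun i hi => Nat.pow_le_pow_right (by omega) hi
  have h1 := hpow 1 (by decide)
  have h2 := hpow 2 (by decide)
  have h3 := hpow 3 (by decide)
  have h4 := hpow 4 (by decide)
  have hX : x ^ 5 ≤ x ^ 5 * p := Nat.le_mul_of_pos_right _ hp
  calc _ ≤ 5 + (x * (2 + 2) + 2 + (x * (2 + 2) + 2 + 2)) + (2 + (x * (3 + 2) + 2) +
        (2 + (x * (4 + 2) + 2) +
        (2 + (x * (2 + (x * (2 + (x * (5 + (x * 12 + 2 + 3) + 2) + 2 + 2) + 2) + 2 + 2) + 2) + 2) +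
        (3 + (x * (6 + (6 + 2) + 2) + 2) +
        ((x + 1) * x ^ 2 * p * (4 + (5 + (x * (x * 17 + 29 + 2) + 2) + 1 + 2) + 1) + 1))))) := by
        gcongr
    _ = (29 + 43 * x + 8 * x ^ 2 + 12 * x ^ 3 + 12 * x ^ 4) +
        (17 * x ^ 5 + 48 * x ^ 4 + 46 * x ^ 3 + 15 * x ^ 2) * p := by
        ring
    _ ≤ 104 * x ^ 5 * p + 126 * x ^ 5 * p := by
        gcongr
        · nlinarith
        · nlinarith
    -- as `x ≥ 2`, numerical factors are absorbed by powers of `x`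
    _ ≤ 2 ^ 8 * x ^ 5 * p := by
        rw [← Nat.add_mul, ← Nat.add_mul]
        gcongr
        decide
    _ ≤ x ^ 8 * x ^ 5 * p := by gcongr
    _ = x ^ 13 * p := by ring

theorem HasTimeEdge.two_le {n : ℕ} {G : TemporalGraph (Fin n)} (hG : G.HasTimeEdge) : 2 ≤ n := by
  obtain ⟨e, t, h⟩ := hG
  induction e with
  | _ u v =>
    have huv : (u : ℕ) ≠ v := fun huv => h.ne (Fin.ext huv)
    omega

theorem HasTimeEdge.lifetime_pos {n : ℕ} {G : TemporalGraph (Fin n)} (hG : G.HasTimeEdge) :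
    1 ≤ G.lifetime := by
  obtain ⟨e, he⟩ := (G.isGreatest_lifetime hG).1
  exact he.pos

theorem hamiltonianProg_decides (x : Instance) {T : ℕ}
    (hT : (x.n * x.graph.lifetime) ^ 13 * 3 ^ (13 * x.graph.timWidth ^ 3) ≤ T) :
    DecidesWithin hamiltonianProg x.graph.encode x.graph.HasHamiltonianPath T := by
  obtain ⟨t, s, he, ht, hs⟩ := hamiltonianProg_runs x.hasTimeEdge
  have h2 := x.hasTimeEdge.two_le
  have h1 := x.hasTimeEdge.lifetime_pos
  refine ⟨t, s, he, (ht.trans (time_le (x := x.n * x.graph.lifetime) ?_ ?_ ?_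
    Nat.one_le_two_pow)).trans (le_trans (Nat.mul_le_mul_left _ ?_) hT),
    fun h => by rw [hs, ind_true h], fun h => by rw [hs, ind_false h]⟩
  · exact Nat.le_mul_of_pos_right _ h1
  · exact Nat.le_mul_of_pos_left _ (by omega)
  · exact h2.trans (Nat.le_mul_of_pos_right _ h1)
  · refine (Nat.pow_le_pow_left (by decide : 2 ≤ 3) _).trans (Nat.pow_le_pow_right (by decide) ?_)
    exact (Nat.le_self_pow (by decide) _).trans (Nat.le_mul_of_pos_left _ (by decide))

theorem computable_bound (c : ℕ) : Computable fun k : ℕ => 3 ^ (c * k ^ 3) := by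
  have hmul : Primrec fun k : ℕ => c * (k * k * k) :=
    Primrec.nat_mul.comp (Primrec.const c)
      (Primrec.nat_mul.comp (Primrec.nat_mul.comp .id .id) .id)
  have hpow : Primrec fun m : ℕ => 3 ^ m :=
    (Primrec.nat_rec₁ 1 (f := fun _ b => 3 * b)
      (Primrec.nat_mul.comp (Primrec.const 3) Primrec.snd)).of_eq fun m => by
        induction m with
        | zero => rfl
        | succ m ih => rw [pow_succ', ← ih]
  refine ((hpow.comp hmul).of_eq fun k => ?_).to_comp
  rw [pow_three, mul_assoc]

end TemporalGraph

theorem mainTheorem7 :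
    (∃ (p : RAM.Prog) (c : ℕ), ∀ x : TemporalGraph.Instance,
      RAM.DecidesWithin p x.graph.encode x.graph.HasHamiltonianPath
        ((x.n * x.graph.lifetime) ^ c * 3 ^ (c * x.graph.timWidth ^ 3))) ∧
    RAM.FixedParameterTractable (fun x : TemporalGraph.Instance => x.graph.encode)
      (fun x => x.graph.HasHamiltonianPath) (fun x => x.graph.timWidth) := by
  refine ⟨⟨TemporalGraph.hamiltonianProg, 13, fun x =>
    TemporalGraph.hamiltonianProg_decides x le_rfl⟩,
    TemporalGraph.hamiltonianProg, fun k => 3 ^ (13 * k ^ 3), 13,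
    TemporalGraph.computable_bound 13, fun x => TemporalGraph.hamiltonianProg_decides x ?_⟩
  rw [Nat.mul_comm]
  gcongr
  rw [TemporalGraph.length_encode]
  calc x.n * x.graph.lifetime ≤ x.n * x.graph.lifetime * x.n :=
        Nat.le_mul_of_pos_right _ (by have := x.hasTimeEdge.two_le; omega)
    _ ≤ 2 + x.graph.lifetime * (x.n * x.n) := by
        rw [Nat.mul_comm x.n, Nat.mul_assoc]
        exact Nat.le_add_left _ _
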